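/- **Setting.** Let $A$ be a commutative $\mathbb{Q}$-algebra with a derivation $\partial=\,_x$ (for example smooth functions of $x$). For $n\ge 1$ and $q=(q_1,\dots,q_n)\in A^n$ put $q_0=1$, $q_\alpha=0$ for $\alpha>n$. Define the potentials $V_i^{(k)}$ ($k\in\mathbb{Z}$) by $V_i^{(0)}=\delta_{in}$, $V_i^{(k+1)}=V_{i+1}^{(k)}-q_iV_1^{(k)}$ for $k\ge 0$ and $V_i^{(k)}=V_{i-1}^{(k+1)}-\frac{q_{i-1}}{q_n}V_n^{(k+1)}$ for $k<0$ ($1\le i\le n$; $V_i^{(k)}=0$ for $i\le 0$ or $i>n$; negative $k$ are used only where $q_n$ is invertible). Let $$L^{n,m,k}_{\varepsilon}=\tfrac14\sum_{i,j=1}^n V_1^{(2n-m-i-j)}q_{i,x}q_{j,x}-\tfrac{\varepsilon}{4}V_1^{(k)},\qquad E_i=\frac{\partial}{\partial q_i}-\partial\,\frac{\partial}{\partial q_{i,x}},$$ and let $Z_r$ be the Killing vector field with components $$(Z_r)^j=(q_{j+r-1})_x+\sum_{k=1}^{j-1}\bigl(q_k(q_{j+r-k-1})_x-q_{j+r-k-1}(q_k)_x\bigr).$$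 Fix $N\ge 1$ and write $\bar q=(q_1,\dots,q_N)$. For a rule $F$ assigning $F[\bar q]\in A^N$ to $\bar q\in A^N$, $F'[\bar q](v)$ is the coefficient of $\epsilon$ in $F[\bar q+\epsilon v]$, computed over $A[\epsilon]$, $\epsilon^2=0$, $\partial\epsilon=0$; the commutator is $[F,G][\bar q]=G'[\bar q](F[\bar q])-F'[\bar q](G[\bar q])$. **(1) Nonlocal hierarchy.** Let $V\subseteq A$ be a (not necessarily unital) $\mathbb{Q}$-subalgebra such that $\partial$ restricts to a bijection $V\to V$, so that $\partial^{-1}$ makes sense on $V$ (for example smooth functions vanishing near $-\infty$, with $\partial^{-1}=\int_{-\infty}^x$); over $A[\epsilon]$ replace $V$ by $V+\epsilon V$. Let $s\ge 2$ and $n=s+N-1$. For every $\bar q\in V^N$ the equations $E_i(L^{n,-N,0}_{1})=0$, $i=N+1,\dots,n$, have exactly one solution $q_{N+1},\dots,q_n\in V$. Substituting it into the first $N$ components of $Z_r$, $2\le r\le s$, gives $\bar Z_r^N[\bar q]\in V^N$, which does not depend on $s$. These fields satisfy, on $V^N$, $$[\bar Z_i^N,\bar Z_j^N]=0\quad\text{and}\quad[\bar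 Z_i^N,\bar Z_1^N]=0\quad\text{for all } i,j\ge 2,\qquad \bar Z_1^N[\bar q]=\bar q_x .$$ **(2) Arbitrary integration parameters.** Let $q=(q_1,q_2,\dots)$ be a sequence in an arbitrary $A$ as above satisfying $E_i(L^{n,-N,0}_{1})[q_1,\dots,q_n]=0$ whenever $N<i\le n$ (so that $q_{N+1},q_{N+2},\dots$ are determined by $\bar q$ only up to integration parameters). Then for every $r\ge 1$ the sequence $q+\epsilon Z_r[q]$ (no truncation of indices) satisfies the same equations over $A[\epsilon]$, i.e. $Z_r$ is tangent to the set of such sequences, and $[Z_i,Z_j]=0$ in every component at $q$ for all $i,j\ge 1$; here $Z_1=q_x$. **(3) Local hierarchy.** Let $W\subseteq A$ be a set of units on which $b\mapsto b^2$ is injective (a branch of the square root, for example the positive functions); over $A[\epsilon]$ replace $W$ by $W+\epsilon A$. Let $\bar q\in A^N$ be such that $E_1(L^{N+1,1,-N-1}_{-1})=0$, an equation of the form $\frac1{4q_{N+1}^2}+\gamma[\bar q]=0$, has a solution $q_{N+1}\in W$. Then the same holds for $\bar q+\epsilon v$ over $A[\epsilon]$, for every $v\in A^N$. For $s\ge 1$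 and $n=s+N$ the equations $E_i(L^{n,n-N,-n}_{-1})=0$, $i=1,\dots,n-N$, have exactly one solution $q_{N+1},\dots,q_n\in A$ with $q_n\in W$. Substituting it into the first $N$ components of $Z_{n-p+1}$, $1\le p\le s$, gives $\bar X_p^N[\bar q]$, which does not depend on $s$, and at every such $\bar q$ $$[\bar X_i^N,\bar X_j^N]=0\quad\text{and}\quad[\bar X_i^N,\bar q_x]=0\quad\text{for all } i,j\ge 1 .$$ -/

import Mathlib

universe u

open TrivSqZeroExt

namespace HarryDym

/-! ### Differential rings and dual numbers

Field variables take values in a commutative `ℚ`-algebra `A` with a derivation `D`, which plays the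
role of `∂ = d/dx`. Derivatives of (integral-)differential expressions are taken with the help of
the dual numbers `A[ε]`, `ε ^ 2 = 0`: the derivative of `F` at `q` in the direction `v` is the
coefficient of `ε` in `F (q + ε v)`. -/

section Basic

variable {A : Type u} [CommRing A] [Algebra ℚ A]

/-- The element `a + ε b` of `A[ε]`. -/
def pt (a b : A) : DualNumber A := inl a + inr b

/-- The extension of the derivation `D` to `A[ε]` with `D ε = 0`, i.e. `D (a + ε b) = D a + ε D b`. -/
def dualD (D : Derivation ℚ A A) : Derivation ℚ (DualNumber A) (DualNumber A) :=
  Derivation.mk'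
    { toFun := fun z => pt (D z.fst) (D z.snd)
      map_add' := fun x y => by ext <;> simp [pt]
      map_smul' := fun c x => by ext <;> simp [pt] }
    (fun x y => by
      ext
      · simp [pt]
      · simp [pt]
        ring)

/-- For a point `q = (q_1, …, q_n)`, the value `q_i` of the coordinate with the (one-based) index
`i`, with the conventions `q_0 = 1` and `q_i = 0` for `i > n`. -/
def coord {n : ℕ} (q : Fin n → A) (i : ℕ) : A :=
  if i = 0 then 1 else if h : i - 1 < n then q ⟨i - 1, h⟩ else 0

/-! ### Potentials, Lagrangians, Euler–Lagrange expressions -/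

/-- `potPos q k i` is `V_i^{(k)}` for `k ≥ 0`: `V_i^{(0)} = δ_{i n}` and
`V_i^{(k+1)} = V_{i+1}^{(k)} - q_i V_1^{(k)}` for `1 ≤ i ≤ n`, all others being zero. -/
def potPos {n : ℕ} (q : Fin n → A) : ℕ → ℕ → A
  | 0, i => if i = n then 1 else 0
  | k + 1, i =>
    if 1 ≤ i ∧ i ≤ n then potPos q k (i + 1) - coord q i * potPos q k 1 else 0

/-- `potNeg q k i` is `V_i^{(-k)}` for `k ≥ 0`: the reversed recursion
`V_i^{(-k-1)} = V_{i-1}^{(-k)} - (q_{i-1} / q_n) V_n^{(-k)}` for `1 ≤ i ≤ n`, all others being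
zero. It is used only where `q_n` is a unit. -/
noncomputable def potNeg {n : ℕ} (q : Fin n → A) : ℕ → ℕ → A
  | 0, i => if i = n then 1 else 0
  | k + 1, i =>
    if 1 ≤ i ∧ i ≤ n then
      potNeg q k (i - 1) - coord q (i - 1) * Ring.inverse (coord q n) * potNeg q k n
    else 0

/-- The potential `V_i^{(k)}`, `k ∈ ℤ`, in Viète coordinates. -/
noncomputable def pot {n : ℕ} (q : Fin n → A) : ℤ → ℕ → A
  | Int.ofNat k, i => potPos q k i
  | Int.negSucc k, i => potNeg q (k + 1) i

/-- The covariant metric `g^{(m)}` in Viète coordinates, `g_{ij} = V_1^{(2n - m - i - j)}`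
(the elements `i`, `j` of `Fin n` stand for the indices `i + 1`, `j + 1`). -/
noncomputable def metric {n : ℕ} (m : ℤ) (q : Fin n → A) (i j : Fin n) : A :=
  pot q (2 * (n : ℤ) - m - ((i : ℕ) + 1) - ((j : ℕ) + 1)) 1

/-- The Lagrangian `L^{n,m,k} (q, v) = (1/4) v^T g^{(m)} v - (e/4) V_1^{(k)}`, where `e = ±1` is the
sign in the separation relations and `v` stands for `q_x`. -/
noncomputable def lagrangian {n : ℕ} (m k : ℤ) (e : ℚ) (q v : Fin n → A) : A :=
  (1 / 4 : ℚ) • (∑ i, ∑ j, v i * metric m q i j * v j) - (e / 4) • pot q k 1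

/-- The Euler–Lagrange expression `E_i (L^{n,m,k}) = ∂L/∂q_i - d/dx (∂L/∂q_{i,x})`. -/
noncomputable def eulerLagrange (D : Derivation ℚ A A) {n : ℕ} (m k : ℤ) (e : ℚ)
    (q : Fin n → A) (i : Fin n) : A :=
  (lagrangian m k e (fun j => pt (q j) (if j = i then 1 else 0))
      (fun j => pt (D (q j)) 0)).snd
    - D (lagrangian m k e (fun j => pt (q j) 0)
      (fun j => pt (D (q j)) (if j = i then 1 else 0))).snd

/-! ### Killing systems -/

/-- The `j`-th component of the Killing vector field `Z_r`, in Viète coordinates: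
`(q_{j+r-1})_x + ∑_{k=1}^{j-1} (q_k (q_{j+r-k-1})_x - q_{j+r-k-1} (q_k)_x)`, for `j, r ≥ 1`. -/
def killing (D : Derivation ℚ A A) (r : ℕ) (Q : ℕ → A) (j : ℕ) : A :=
  D (Q (j + r - 1)) + ∑ k ∈ Finset.Icc 1 (j - 1),
    (Q k * D (Q (j + r - k - 1)) - Q (j + r - k - 1) * D (Q k))

/-! ### Eliminations -/

/-- `Q = (q_1, …, q_n)` solves the elimination equations of the nonlocal hierarchy,
`E_i (L^{n,-N,0}) = 0` for `N < i ≤ n`, inside `V`, and its first `N` entries are `q`. -/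
def IsNonlocalElim (D : Derivation ℚ A A) (V : Set A) {N n : ℕ} (q : Fin N → A)
    (Q : Fin n → A) : Prop :=
  (∀ j : Fin N, coord Q (j + 1) = q j) ∧ (∀ i, Q i ∈ V) ∧
    ∀ i : Fin n, N ≤ (i : ℕ) → eulerLagrange D (-(N : ℤ)) 0 1 Q i = 0

/-- `Q = (q_1, …, q_n)` solves the elimination equations of the local hierarchy,
`E_i (L^{n,n-N,-n}) = 0` for `1 ≤ i ≤ n - N` (with sign `-1`), with `q_n ∈ W`, and its first `N`
entries are `q`. -/
def IsLocalElim (D : Derivation ℚ A A) (W : Set A) {N n : ℕ} (q : Fin N → A)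
    (Q : Fin n → A) : Prop :=
  (∀ j : Fin N, coord Q (j + 1) = q j) ∧ coord Q n ∈ W ∧
    ∀ i : Fin n, (i : ℕ) + N < n → eulerLagrange D ((n : ℤ) - N) (-(n : ℤ)) (-1) Q i = 0

open Classical in
/-- The result of the nonlocal elimination: the point `(q_1, …, q_n)` in which `q_{N+1}, …, q_n`
are expressed through `q_1, …, q_N`. -/
noncomputable def nonlocalElim (D : Derivation ℚ A A) (V : Set A) {N : ℕ} (n : ℕ)
    (q : Fin N → A) : Fin n → A :=
  if h : ∃ Q : Fin n → A, IsNonlocalElim D V q Q then h.choose else 0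

open Classical in
/-- The result of the local elimination. -/
noncomputable def localElim (D : Derivation ℚ A A) (W : Set A) {N : ℕ} (n : ℕ)
    (q : Fin N → A) : Fin n → A :=
  if h : ∃ Q : Fin n → A, IsLocalElim D W q Q then h.choose else 0

/-- A set of units of `A` on which squaring is injective, for instance the positive functions:
it selects a branch of the square root. -/
def IsBranch (W : Set A) : Prop :=
  (∀ b ∈ W, IsUnit b) ∧ Set.InjOn (fun b => b ^ 2) W

/-- The domain of the local hierarchy: those `q = (q_1, …, q_N)` for which the equation
`E_1 (L^{N+1,1,-N-1}) = 0` for `q_{N+1}`, i.e. `1 / (4 q_{N+1}^2) + γ [q_1, …, q_N] = 0`, has a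
solution in `W`. -/
def LocalDomain (D : Derivation ℚ A A) (W : Set A) {N : ℕ} (q : Fin N → A) : Prop :=
  ∃ Q : Fin (N + 1) → A, IsLocalElim D W q Q

end Basic

/-! ### Vector fields and their commutators -/

/-- Rules that assign to every differential ring `A`, set `S ⊆ A` (which fixes the meaning of
`∂⁻¹` or of the square root) and `q ∈ A ^ N` an element of `A ^ N`; thought of as vector fields
`q_t = F[q]`. -/
abbrev VField (N : ℕ) : Type (u + 1) :=
  ∀ (A : Type u) [CommRing A] [Algebra ℚ A], Derivation ℚ A A → Set A → (Fin N → A) → Fin N → A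

/-- Over `A[ε]`, `V` is replaced by `V[ε] = V + ε V`. -/
def nonlocalLift (A : Type u) [CommRing A] (V : Set A) : Set (DualNumber A) :=
  {z | z.fst ∈ V ∧ z.snd ∈ V}

/-- Over `A[ε]`, `W` is replaced by `W + ε A`. -/
def localLift (A : Type u) [CommRing A] (W : Set A) : Set (DualNumber A) :=
  {z | z.fst ∈ W}

/-- The commutator `[F, G][q] = G'[q](F[q]) - F'[q](G[q])`, where `F'[q](v)` is the coefficient of
`ε` in `F[q + ε v]`. -/
def bracket (lift : ∀ (A : Type u) [CommRing A], Set A → Set (DualNumber A)) {N : ℕ}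
    (F G : VField.{u} N) : VField.{u} N :=
  fun A _ _ D S q j =>
    (G (DualNumber A) (dualD D) (lift A S) (fun i => pt (q i) (F A D S q i)) j).snd
      - (F (DualNumber A) (dualD D) (lift A S) (fun i => pt (q i) (G A D S q i)) j).snd

/-- The vector field `q_x = (q_{1,x}, …, q_{N,x})`. -/
def translation (N : ℕ) : VField.{u} N := fun _ _ _ D _ q j => D (q j)

/-- The `r`-th vector field, `2 ≤ r ≤ s`, in the `N`-component nonlocal system produced by the
elimination with `n = s + N - 1`. -/
noncomputable def nonlocalField (N s r : ℕ) : VField.{u} N := fun _ _ _ D V q j =>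
  killing D r (coord (nonlocalElim D V (s + N - 1) q)) (j + 1)

/-- The vector field `Z̄_r^N` of the nonlocal hierarchy. -/
noncomputable def Zbar (N r : ℕ) : VField.{u} N := nonlocalField N r r

/-- The `p`-th vector field, `1 ≤ p ≤ s`, in the `N`-component local system produced by the
elimination with `n = s + N`; it comes from the Killing vector field `Z_{n-p+1}`. -/
noncomputable def localField (N s p : ℕ) : VField.{u} N := fun _ _ _ D W q j =>
  killing D (s + N - p + 1) (coord (localElim D W (s + N) q)) (j + 1)

/-- The vector field `X̄_p^N` of the local hierarchy. -/
noncomputable def Xbar (N p : ℕ) : VField.{u} N := localField N p p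

/-- The elimination equations of the nonlocal hierarchy for a sequence `q_1, q_2, …` in `A`
(the entry `Q 0` is not used): `E_i (L^{n,-N,0}) [q_1, …, q_n] = 0` whenever `N < i ≤ n`. -/
def SolvesElim {A : Type u} [CommRing A] [Algebra ℚ A] (D : Derivation ℚ A A) (N : ℕ)
    (Q : ℕ → A) : Prop :=
  ∀ (n : ℕ) (i : Fin n), N ≤ (i : ℕ) →
    eulerLagrange D (-(N : ℤ)) 0 1 (fun j : Fin n => Q (j + 1)) i = 0

end HarryDym

/-! Put `X` = 1/λ and f = 1 + q_1 X + q_2 X² + …, and let P be the reversed polynomial λ^n f, a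
series in λ. The recursions for the potentials are long divisions: V_1^(k) is, up to a shift and a
sign, a coefficient of 1/f (k ≥ 0) or of 1/P (k < 0). So the Lagrangians are built from coefficients
of f_x²/f and P_x²/P, and the Euler–Lagrange expressions from coefficients of `schw`, S[f] = f_x²/f²
- 2 f_xx/f; in the local case the potential adds P⁻². The Killing field Z_{r+1} becomes f_t = λ^r (a
f_x - a_x f), where a is the part of f of degree ≤ r in `X`. Everything rests on two facts: these
flows commute (`zero_curvature`, `killS_comm`), and along them S_t = λ^r (a S_x + 2 a_x S + 2 a_xxx)
(`schw_flow`).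

Nonlocal case: elimination says that S[f] is a polynomial of degree ≤ N in `X`. The formula for S_t
preserves this by counting degrees (`coeff_schw_flow`). The coefficient of X^k in S is -2 q_{k,xx}
plus terms in earlier entries, so inverting ∂ twice determines q_k.

Local case: elimination says u - λ^N S[P] + P⁻² = O(λ^(n-N)), where u is the polynomial part of λ^N
S[f] and involves only q_1, …, q_N. This is an algebraic recursion for q_n, q_{n-1}, …, which does
not mention n. On solutions P is annihilated, up to that order, by a third order operator; splitting
P into its first p terms and the rest shows that Z_{n-p+1} preserves the equations with a loss of p
orders (`X_pow_dvd_defect_variation`).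

Commutators: uniqueness of elimination also holds over A[ε]. By tangency the elimination at q̄ + ε
Z[q̄] is therefore the flow of the eliminated point (in the local case, in the entries that matter),
and the commutators reduce to those of the Killing fields. The field q_x is Z_1. -/

namespace HarryDym

open PowerSeries (X coeff mk C)
open scoped PowerSeries

set_option linter.unusedSectionVars false

/-! ### Differential calculus of power series, `schw` and its variation. -/

section Series

variable {A : Type u} [CommRing A] [Algebra ℚ A]

/-- The coefficientwise extension of a derivation to power series. -/
noncomputable def coeffD (D : Derivation ℚ A A) : Derivation ℚ A⟦X⟧ A⟦X⟧ :=
  Derivation.mk'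
    { toFun := fun f => mk fun k => D (coeff k f)
      map_add' := fun f g => by ext; simp
      map_smul' := fun c f => by
        ext k
        have h (g : A⟦X⟧) : coeff k (c • g) = c • coeff k g := rfl
        simp only [PowerSeries.coeff_mk, RingHom.id_apply, h, Derivation.map_smul, PowerSeries.coeff_mk] }
    (fun f g => by
      ext k
      simp only [LinearMap.coe_mk, AddHom.coe_mk, PowerSeries.coeff_mk, PowerSeries.coeff_mul,
        map_sum, Derivation.leibniz, smul_eq_mul, map_add, Finset.sum_add_distrib]
      congr 1
      exact Finset.Nat.sum_antidiagonal_swap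
        (f := fun p : ℕ × ℕ => coeff p.1 g * D (coeff p.2 f)))

@[simp] lemma coeff_coeffD (D : Derivation ℚ A A) (f : A⟦X⟧) (k : ℕ) :
    coeff k (coeffD D f) = D (coeff k f) := by
  change coeff k (mk fun k => D (coeff k f)) = _
  rw [PowerSeries.coeff_mk]

@[simp] lemma coeffD_X_pow (D : Derivation ℚ A A) (k : ℕ) : coeffD D (X ^ k : A⟦X⟧) = 0 := by
  ext m
  rw [coeff_coeffD, PowerSeries.coeff_X_pow]
  split_ifs <;> simp

@[simp] lemma coeffD_X (D : Derivation ℚ A A) : coeffD D (X : A⟦X⟧) = 0 := by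
  simpa using coeffD_X_pow D 1

lemma coeffD_mul (D : Derivation ℚ A A) (f g : A⟦X⟧) :
    coeffD D (f * g) = f * coeffD D g + g * coeffD D f := by
  rw [Derivation.leibniz, smul_eq_mul, smul_eq_mul]

lemma coeffD_X_pow_mul (D : Derivation ℚ A A) (k : ℕ) (f : A⟦X⟧) :
    coeffD D (X ^ k * f) = X ^ k * coeffD D f := by
  rw [coeffD_mul, coeffD_X_pow, mul_zero, add_zero]

lemma coeffD_two (D : Derivation ℚ A A) : coeffD D (2 : A⟦X⟧) = 0 := by
  simpa using Derivation.map_natCast (coeffD D) 2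

lemma inverse_eq_of_mul_eq_one {R : Type*} [CommRing R] {f g : R} (h : f * g = 1) :
    Ring.inverse f = g := by
  have hu : IsUnit f := IsUnit.of_mul_eq_one _ h
  calc Ring.inverse f = Ring.inverse f * (f * g) := by rw [h, mul_one]
    _ = g := Ring.inverse_mul_cancel_left _ _ hu

lemma coeffD_inverse (D : Derivation ℚ A A) {f : A⟦X⟧} (hf : IsUnit f) :
    coeffD D (Ring.inverse f) = -(coeffD D f * Ring.inverse f ^ 2) := by
  have h := Ring.mul_inverse_cancel f hf
  have h2 : coeffD D (f * Ring.inverse f) = 0 := by rw [h]; exact Derivation.map_one_eq_zero _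
  rw [coeffD_mul] at h2
  linear_combination Ring.inverse f * h2 - coeffD D (Ring.inverse f) * h

/-- The logarithmic derivative `f_x / f`. -/
noncomputable def logD (D : Derivation ℚ A A) (f : A⟦X⟧) : A⟦X⟧ := coeffD D f * Ring.inverse f

/-- `4 U`, where `U = f_x ^ 2 / (4 f ^ 2) - f_xx / (2 f)`. -/
noncomputable def schw (D : Derivation ℚ A A) (f : A⟦X⟧) : A⟦X⟧ :=
  -(2 * coeffD D (logD D f)) - logD D f ^ 2

/-- The bracket `f g_x - f_x g`. -/
noncomputable def wron (D : Derivation ℚ A A) (f g : A⟦X⟧) : A⟦X⟧ :=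
  f * coeffD D g - coeffD D f * g

lemma coeffD_eq_logD_mul (D : Derivation ℚ A A) {f : A⟦X⟧} (hf : IsUnit f) :
    coeffD D f = logD D f * f := by
  rw [logD, mul_assoc, Ring.inverse_mul_cancel f hf, mul_one]

lemma sq_mul_schw (D : Derivation ℚ A A) {f : A⟦X⟧} (hf : IsUnit f) :
    f ^ 2 * schw D f = coeffD D f ^ 2 - 2 * f * coeffD D (coeffD D f) := by
  have h := coeffD_eq_logD_mul D hf
  have h2 : coeffD D (coeffD D f) = logD D f * (logD D f * f) + f * coeffD D (logD D f) := by
    conv_lhs => rw [h]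
    rw [coeffD_mul, h]
  rw [h2, h, schw]
  ring

/-- The third order operator dual to the evolution of `schw` along `f ↦ wron a f`. -/
lemma third_order_apply_self (D : Derivation ℚ A A) {f : A⟦X⟧} (hf : IsUnit f) :
    coeffD D (schw D f) * f + 2 * schw D f * coeffD D f
      + 2 * coeffD D (coeffD D (coeffD D f)) = 0 := by
  have h := coeffD_eq_logD_mul D hf
  have h2 : coeffD D (coeffD D f) = logD D f * (logD D f * f) + f * coeffD D (logD D f) := by
    conv_lhs => rw [h]
    rw [coeffD_mul, h]
  rw [h2]
  simp only [map_add, h, schw, map_sub, map_neg, coeffD_mul, coeffD_two, pow_two]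
  ring

/-! ### Power series over the dual numbers -/

/-- The power series `f + ε g`. -/
noncomputable def ptS (f g : A⟦X⟧) : (DualNumber A)⟦X⟧ := mk fun k => pt (coeff k f) (coeff k g)

@[simp] lemma fst_pt (a b : A) : (pt a b).fst = a := by simp [pt]

@[simp] lemma snd_pt (a b : A) : (pt a b).snd = b := by simp [pt]

lemma pt_fst_snd (z : DualNumber A) : pt z.fst z.snd = z := by ext <;> simp

@[simp] lemma pt_one_zero : pt (1 : A) 0 = 1 := by ext <;> simp

@[simp] lemma pt_zero_zero : pt (0 : A) 0 = 0 := by ext <;> simp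

@[simp] lemma dualD_pt (D : Derivation ℚ A A) (a b : A) :
    dualD D (pt a b) = pt (D a) (D b) := by
  change pt (D (pt a b).fst) (D (pt a b).snd) = _
  simp

@[simp] lemma coeff_ptS (f g : A⟦X⟧) (k : ℕ) : coeff k (ptS f g) = pt (coeff k f) (coeff k g) :=
  PowerSeries.coeff_mk _ _

lemma ptS_add (f g f' g' : A⟦X⟧) : ptS f g + ptS f' g' = ptS (f + f') (g + g') := by
  ext k <;> simp

lemma ptS_sub (f g f' g' : A⟦X⟧) : ptS f g - ptS f' g' = ptS (f - f') (g - g') := by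
  ext k <;> simp

lemma ptS_neg (f g : A⟦X⟧) : -ptS f g = ptS (-f) (-g) := by
  ext k <;> simp

lemma ptS_mul (f g f' g' : A⟦X⟧) : ptS f g * ptS f' g' = ptS (f * f') (f * g' + g * f') := by
  ext k
  · simp [PowerSeries.coeff_mul, fst_sum]
  · simp [PowerSeries.coeff_mul, snd_sum, Finset.sum_add_distrib]

@[simp] lemma ptS_one : ptS (1 : A⟦X⟧) 0 = 1 := by
  ext k <;> simp [PowerSeries.coeff_one] <;> split_ifs <;> simp

lemma ptS_X_pow (k : ℕ) : ptS (X ^ k : A⟦X⟧) 0 = X ^ k := by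
  ext m <;> simp [PowerSeries.coeff_X_pow] <;> split_ifs <;> simp

lemma ptS_X : ptS (X : A⟦X⟧) 0 = X := by
  simpa using ptS_X_pow (A := A) 1

lemma coeffD_ptS (D : Derivation ℚ A A) (f g : A⟦X⟧) :
    coeffD (dualD D) (ptS f g) = ptS (coeffD D f) (coeffD D g) := by
  ext k <;> simp

lemma ptS_two : (2 : (DualNumber A)⟦X⟧) = ptS 2 0 := by
  have h : (2 : (DualNumber A)⟦X⟧) = 1 + 1 := by norm_num
  rw [h, ← ptS_one, ptS_add]
  norm_num

lemma inverse_ptS {f : A⟦X⟧} (hf : IsUnit f) (g : A⟦X⟧) :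
    Ring.inverse (ptS f g) = ptS (Ring.inverse f) (-(g * Ring.inverse f ^ 2)) := by
  apply inverse_eq_of_mul_eq_one
  have h := Ring.mul_inverse_cancel f hf
  rw [ptS_mul, h, ← ptS_one]
  congr 1
  linear_combination (-(g * Ring.inverse f)) * h

lemma logD_ptS (D : Derivation ℚ A A) {f : A⟦X⟧} (hf : IsUnit f) (g : A⟦X⟧) :
    logD (dualD D) (ptS f g) = ptS (logD D f) (coeffD D (g * Ring.inverse f)) := by
  rw [logD, inverse_ptS hf, coeffD_ptS, ptS_mul, coeffD_mul, coeffD_inverse D hf, logD]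
  congr 1
  ring

/-- The variation of `schw`. -/
lemma schw_ptS (D : Derivation ℚ A A) {f : A⟦X⟧} (hf : IsUnit f) (g : A⟦X⟧) :
    schw (dualD D) (ptS f g) = ptS (schw D f)
      (-(2 * coeffD D (coeffD D (g * Ring.inverse f)))
        - 2 * logD D f * coeffD D (g * Ring.inverse f)) := by
  rw [schw, logD_ptS D hf, coeffD_ptS, pow_two, ptS_mul, ptS_two, ptS_mul, ptS_neg, ptS_sub, schw]
  congr 1 <;> ring

/-- The evolution of `schw` along the flow `f ↦ X ^ (-e) (a f_x - a_x f)`. -/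
lemma schw_flow (D : Derivation ℚ A A) {f : A⟦X⟧} (hf : IsUnit f) {a g : A⟦X⟧} {e : ℕ}
    (h : X ^ e * g = wron D a f) :
    X ^ e * (-(2 * coeffD D (coeffD D (g * Ring.inverse f)))
        - 2 * logD D f * coeffD D (g * Ring.inverse f))
      = a * coeffD D (schw D f) + 2 * coeffD D a * schw D f
        + 2 * coeffD D (coeffD D (coeffD D a)) := by
  -- Divided by f, the flow involves f only through w = `logD D f`, and so does `schw`. What remains
  -- is a polynomial identity in a, w and their derivatives.
  have hz : X ^ e * (g * Ring.inverse f) = a * logD D f - coeffD D a := by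
    rw [← mul_assoc, h, wron, logD]
    linear_combination (-coeffD D a) * Ring.mul_inverse_cancel f hf
  have h1 : X ^ e * coeffD D (g * Ring.inverse f) = coeffD D (a * logD D f - coeffD D a) := by
    rw [← coeffD_X_pow_mul, hz]
  have h2 : X ^ e * coeffD D (coeffD D (g * Ring.inverse f))
      = coeffD D (coeffD D (a * logD D f - coeffD D a)) := by
    rw [← coeffD_X_pow_mul, h1]
  calc _ = -(2 * (X ^ e * coeffD D (coeffD D (g * Ring.inverse f))))
        - 2 * logD D f * (X ^ e * coeffD D (g * Ring.inverse f)) := by ring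
    _ = _ := by
      rw [h1, h2]
      simp only [schw, map_sub, map_add, map_neg, coeffD_mul, coeffD_two, pow_two]
      ring

/-- The variation of `schw` along `f_x` is its derivative. -/
lemma schw_ptS_coeffD (D : Derivation ℚ A A) {f : A⟦X⟧} (hf : IsUnit f) :
    schw (dualD D) (ptS f (coeffD D f)) = ptS (schw D f) (coeffD D (schw D f)) := by
  rw [schw_ptS D hf]
  congr 1
  rw [← logD]
  simp only [schw, map_sub, map_neg, coeffD_mul, coeffD_two, pow_two]
  ring

/-! ### Shifts -/

/-- The series `f` with the terms of degree `< r` dropped, divided by `X ^ r`. -/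
noncomputable def shiftS (r : ℕ) (f : A⟦X⟧) : A⟦X⟧ := mk fun m => coeff (r + m) f

/-- The sum of the terms of degree `< r` of `f`. -/
noncomputable def lowS (r : ℕ) (f : A⟦X⟧) : A⟦X⟧ := mk fun m => if m < r then coeff m f else 0

@[simp] lemma coeff_shiftS (r m : ℕ) (f : A⟦X⟧) : coeff m (shiftS r f) = coeff (r + m) f :=
  PowerSeries.coeff_mk _ _

@[simp] lemma coeff_lowS (r m : ℕ) (f : A⟦X⟧) :
    coeff m (lowS r f) = if m < r then coeff m f else 0 :=
  PowerSeries.coeff_mk _ _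

lemma lowS_add_X_pow_mul_shiftS (r : ℕ) (f : A⟦X⟧) : lowS r f + X ^ r * shiftS r f = f := by
  ext m
  rw [map_add, coeff_lowS, PowerSeries.coeff_X_pow_mul']
  split_ifs with h1 h2 h2
  · omega
  · simp
  · rw [coeff_shiftS, Nat.add_sub_cancel' h2, zero_add]
  · omega

/-- `f` has degree at most `d`. -/
def DegLE (f : A⟦X⟧) (d : ℕ) : Prop := ∀ k, d < k → coeff k f = 0

lemma DegLE.add {f g : A⟦X⟧} {d : ℕ} (hf : DegLE f d) (hg : DegLE g d) : DegLE (f + g) d :=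
  fun k hk => by rw [map_add, hf k hk, hg k hk, add_zero]

lemma DegLE.sub {f g : A⟦X⟧} {d : ℕ} (hf : DegLE f d) (hg : DegLE g d) : DegLE (f - g) d :=
  fun k hk => by rw [map_sub, hf k hk, hg k hk, sub_zero]

lemma DegLE.mul {f g : A⟦X⟧} {d e : ℕ} (hf : DegLE f d) (hg : DegLE g e) :
    DegLE (f * g) (d + e) := fun k hk => by
  rw [PowerSeries.coeff_mul]
  refine Finset.sum_eq_zero fun p hp => ?_
  have hp := Finset.HasAntidiagonal.mem_antidiagonal.1 hp
  rcases lt_or_ge d p.1 with h | h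
  · rw [hf _ h, zero_mul]
  · rw [hg _ (by omega), mul_zero]

lemma DegLE.coeffD {f : A⟦X⟧} {d : ℕ} (hf : DegLE f d) (D : Derivation ℚ A A) :
    DegLE (coeffD D f) d := fun k hk => by rw [coeff_coeffD, hf k hk, map_zero]

lemma DegLE.mono {f : A⟦X⟧} {d e : ℕ} (hf : DegLE f d) (h : d ≤ e) : DegLE f e :=
  fun k hk => hf k (by omega)

lemma degLE_two (d : ℕ) : DegLE (2 : A⟦X⟧) d := fun k hk => by
  have : (2 : A⟦X⟧) = C 2 := (map_ofNat C 2).symm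
  rw [this, PowerSeries.coeff_C, if_neg (by omega)]

lemma degLE_X_pow (d : ℕ) : DegLE (X ^ d : A⟦X⟧) d := fun k hk => by
  rw [PowerSeries.coeff_X_pow, if_neg (by omega)]

lemma degLE_lowS (r : ℕ) (f : A⟦X⟧) : DegLE (lowS (r + 1) f) r := fun k hk => by
  rw [coeff_lowS, if_neg (by omega)]

/-! ### Killing flows -/

/-- The generating series of the components of the Killing vector field `Z_r` (`r ≥ 1`). -/
noncomputable def killS (D : Derivation ℚ A A) (r : ℕ) (f : A⟦X⟧) : A⟦X⟧ :=
  -(X * wron D (shiftS r f) f)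

/-- Since `wron D f f` = 0, the tail of f may be traded, up to sign, for its low part. The low part
has bounded degree, which is what the degree arguments need. -/
lemma X_pow_mul_killS (D : Derivation ℚ A A) (r : ℕ) (f : A⟦X⟧) :
    X ^ r * killS D (r + 1) f = wron D (lowS (r + 1) f) f := by
  have h := lowS_add_X_pow_mul_shiftS (r + 1) f
  set a := lowS (r + 1) f
  set b := shiftS (r + 1) f
  have h' : a = f - X ^ (r + 1) * b := by rw [← h]; ring
  rw [h', killS, wron, wron, map_sub, coeffD_X_pow_mul]
  ring

lemma coeff_killS_succ (D : Derivation ℚ A A) (r l : ℕ) (f : A⟦X⟧) :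
    coeff (l + 1) (killS D r f) = ∑ k ∈ Finset.range (l + 1),
      (coeff k f * D (coeff (l + r - k) f) - coeff (l + r - k) f * D (coeff k f)) := by
  rw [killS, map_neg, PowerSeries.coeff_succ_X_mul, wron, map_sub, PowerSeries.coeff_mul,
    PowerSeries.coeff_mul, ← Finset.sum_sub_distrib, ← Finset.sum_neg_distrib,
    Finset.Nat.sum_antidiagonal_eq_sum_range_succ_mk, ← Finset.sum_range_reflect]
  refine Finset.sum_congr rfl fun k hk => ?_
  rw [Finset.mem_range] at hk
  simp only [coeff_shiftS, coeff_coeffD]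
  rw [show r + (l + 1 - 1 - k) = l + r - k by omega, show l - (l + 1 - 1 - k) = k by omega]
  ring

lemma killing_eq_coeff (D : Derivation ℚ A A) (r : ℕ) {Q : ℕ → A} (h0 : Q 0 = 1) {l : ℕ}
    (hl : 1 ≤ l) : killing D r Q l = coeff l (killS D r (mk Q)) := by
  obtain ⟨l, rfl⟩ : ∃ m, l = m + 1 := ⟨l - 1, by omega⟩
  -- The term k = 0 of the sum supplies the leading derivative in `killing`, because q_0 = 1 and its
  -- derivative vanishes.
  rw [coeff_killS_succ, killing, Finset.sum_range_succ', Nat.add_sub_cancel, add_comm]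
  simp only [PowerSeries.coeff_mk, h0, Derivation.map_one_eq_zero]
  have h : Finset.Icc 1 l = Finset.Ico 1 (l + 1) := by ext; simp
  rw [h, Finset.sum_Ico_eq_sum_range, Nat.add_sub_cancel]
  congr 1
  · refine Finset.sum_congr rfl fun k _ => ?_
    rw [add_comm 1 k, show l + 1 + r - (k + 1) - 1 = l + r - (k + 1) by omega]
  · rw [show l + 1 + r - 1 = l + r - 0 by omega]
    ring

end Series

/-! ### Commutativity of the Killing flows. -/

section Commute

variable {A : Type u} [CommRing A] [Algebra ℚ A]

lemma shiftS_ptS (r : ℕ) (f g : A⟦X⟧) :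
    shiftS r (ptS f g) = ptS (shiftS r f) (shiftS r g) := by
  ext k <;> simp

lemma wron_ptS (D : Derivation ℚ A A) (a b f g : A⟦X⟧) :
    wron (dualD D) (ptS a b) (ptS f g) = ptS (wron D a f) (wron D a g + wron D b f) := by
  rw [wron, coeffD_ptS, coeffD_ptS, ptS_mul, ptS_mul, ptS_sub, wron, wron, wron]
  congr 1
  ring

lemma killS_ptS (D : Derivation ℚ A A) (r : ℕ) (f g : A⟦X⟧) :
    killS (dualD D) r (ptS f g) = ptS (killS D r f)
      (-(X * (wron D (shiftS r f) g + wron D (shiftS r g) f))) := by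
  rw [killS, shiftS_ptS, wron_ptS, ← ptS_X, ptS_mul, ptS_neg, killS]
  congr 1
  ring

lemma X_pow_mul_X_mul_shiftS (r : ℕ) (f : A⟦X⟧) :
    X ^ r * (X * shiftS (r + 1) f) = f - lowS (r + 1) f := by
  conv_rhs => rw [← lowS_add_X_pow_mul_shiftS (r + 1) f]
  have h : lowS (r + 1) (lowS (r + 1) f + X ^ (r + 1) * shiftS (r + 1) f) = lowS (r + 1) f := by
    rw [lowS_add_X_pow_mul_shiftS]
  rw [h]
  ring

/-- The zero curvature equations of the Killing flows. -/
lemma zero_curvature (D : Derivation ℚ A A) (i j : ℕ) (f : A⟦X⟧) :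
    X * shiftS (j + 1) (killS D (i + 1) f) - X * shiftS (i + 1) (killS D (j + 1) f)
      + wron D (X * shiftS (i + 1) f) (X * shiftS (j + 1) f) = 0 := by
  set Δ := X * shiftS (j + 1) (killS D (i + 1) f) - X * shiftS (i + 1) (killS D (j + 1) f)
      + wron D (X * shiftS (i + 1) f) (X * shiftS (j + 1) f) with hΔ
  -- Each tail is replaced by its series minus the low part. All terms containing a full series
  -- cancel, and the rest has degree at most i + j. As Δ has no constant term, this forces Δ = 0.
  have key : X ^ (i + j) * Δ =
      wron D (lowS (i + 1) f) (lowS (j + 1) f)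
        - X ^ i * lowS (j + 1) (killS D (i + 1) f)
        + X ^ j * lowS (i + 1) (killS D (j + 1) f) := by
    have hi := X_pow_mul_X_mul_shiftS i (killS D (j + 1) f)
    have hj := X_pow_mul_X_mul_shiftS j (killS D (i + 1) f)
    have hi' := X_pow_mul_X_mul_shiftS i f
    have hj' := X_pow_mul_X_mul_shiftS j f
    have ki := X_pow_mul_killS D i f
    have kj := X_pow_mul_killS D j f
    have hw : X ^ (i + j) * wron D (X * shiftS (i + 1) f) (X * shiftS (j + 1) f)
        = wron D (f - lowS (i + 1) f) (f - lowS (j + 1) f) := by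
      rw [← hi', ← hj', wron, wron, coeffD_X_pow_mul, coeffD_X_pow_mul]
      ring
    rw [hΔ, mul_add, hw, mul_sub]
    have e1 : X ^ (i + j) * (X * shiftS (j + 1) (killS D (i + 1) f))
        = wron D (lowS (i + 1) f) f - X ^ i * lowS (j + 1) (killS D (i + 1) f) := by
      rw [pow_add, mul_assoc, hj, mul_sub, ki]
    have e2 : X ^ (i + j) * (X * shiftS (i + 1) (killS D (j + 1) f))
        = wron D (lowS (j + 1) f) f - X ^ j * lowS (i + 1) (killS D (j + 1) f) := by
      rw [add_comm i j, pow_add, mul_assoc, hi, mul_sub, kj]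
    rw [e1, e2]
    simp only [wron, map_sub]
    ring
  have hdeg : DegLE (X ^ (i + j) * Δ) (i + j) := by
    rw [key]
    have h1 := degLE_lowS i f
    have h2 := degLE_lowS j f
    refine DegLE.add (DegLE.sub (DegLE.sub (h1.mul (h2.coeffD D)) ((h1.coeffD D).mul h2)) ?_) ?_
    · exact (degLE_X_pow i).mul (degLE_lowS j _)
    · rw [add_comm i j]
      exact (degLE_X_pow j).mul (degLE_lowS i _)
  ext m
  rcases Nat.eq_zero_or_pos m with rfl | hm
  · rw [hΔ, wron]
    simp
  · rw [← PowerSeries.coeff_X_pow_mul Δ (i + j) m, hdeg _ (by omega), map_zero]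

/-- The Killing flows commute. -/
lemma killS_comm (D : Derivation ℚ A A) {i j : ℕ} (hi : 1 ≤ i) (hj : 1 ≤ j) (f : A⟦X⟧) (l : ℕ) :
    (coeff l (killS (dualD D) j (ptS f (killS D i f)))).snd
      = (coeff l (killS (dualD D) i (ptS f (killS D j f)))).snd := by
  obtain ⟨i, rfl⟩ : ∃ m, i = m + 1 := ⟨i - 1, by omega⟩
  obtain ⟨j, rfl⟩ : ∃ m, j = m + 1 := ⟨j - 1, by omega⟩
  rw [killS_ptS, killS_ptS, coeff_ptS, coeff_ptS, snd_pt, snd_pt]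
  congr 1
  have hz := zero_curvature D i j f
  have e : ∀ r, X * wron D (shiftS r f) f = wron D (X * shiftS r f) f := fun r => by
    rw [wron, wron, coeffD_mul, coeffD_X]
    ring
  have e' : ∀ r g, X * (wron D (shiftS r f) g + wron D (shiftS r g) f)
      = wron D (X * shiftS r f) g + wron D (X * shiftS r g) f := fun r g => by
    simp only [wron, coeffD_mul, coeffD_X]
    ring
  have hz' : X * shiftS (j + 1) (killS D (i + 1) f) = X * shiftS (i + 1) (killS D (j + 1) f)
      - wron D (X * shiftS (i + 1) f) (X * shiftS (j + 1) f) := by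
    linear_combination hz
  rw [e', e', hz']
  have ki : killS D (i + 1) f = -wron D (X * shiftS (i + 1) f) f := by rw [killS, e]
  have kj : killS D (j + 1) f = -wron D (X * shiftS (j + 1) f) f := by rw [killS, e]
  -- Zero curvature has expressed one of the two time derivatives through the other, which may now
  -- be arbitrary. What is left is the Jacobi identity for `wron`.
  generalize X * shiftS (i + 1) (killS D (j + 1) f) = P
  rw [ki, kj]
  generalize X * shiftS (i + 1) f = a
  generalize X * shiftS (j + 1) f = b
  simp only [wron, map_sub, map_neg, coeffD_mul]
  ring

/-- Entries strictly between the first l - 1 and those from index r on do not occur. In the local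
case this gap contains entries over which the flow gives no control. -/
lemma killing_congr (D : Derivation ℚ A A) (r : ℕ) {Q Q' : ℕ → A} {l : ℕ} (hl : 1 ≤ l)
    (hr : 1 ≤ r) (h : ∀ k, 1 ≤ k → k ≤ l + r - 1 → (k < l ∨ r ≤ k) → Q k = Q' k) :
    killing D r Q l = killing D r Q' l := by
  rw [killing, killing, h (l + r - 1) (by omega) le_rfl (by omega)]
  congr 1
  refine Finset.sum_congr rfl fun k hk => ?_
  rw [Finset.mem_Icc] at hk
  rw [h k (by omega) (by omega) (by omega), h (l + r - k - 1) (by omega) (by omega) (by omega)]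

/-- For r = 1 the summand is antisymmetric under k ↦ l - k. -/
lemma killing_one (D : Derivation ℚ A A) (Q : ℕ → A) {l : ℕ} (hl : 1 ≤ l) :
    killing D 1 Q l = D (Q l) := by
  rw [killing, Nat.add_sub_cancel, add_eq_left, Finset.sum_sub_distrib, sub_eq_zero]
  refine Finset.sum_nbij' (fun k => l - k) (fun k => l - k) ?_ ?_ ?_ ?_ ?_
  all_goals intro k hk
  all_goals rw [Finset.mem_Icc] at hk
  · rw [Finset.mem_Icc]; omega
  · rw [Finset.mem_Icc]; omega
  · omega
  · omega
  · rw [show l + 1 - k - 1 = l - k by omega, show l + 1 - (l - k) - 1 = k by omega]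

/-- The flow of a sequence, with the convention that the entry with index `0` is fixed. -/
noncomputable def flow (D : Derivation ℚ A A) (r : ℕ) (Q : ℕ → A) (k : ℕ) : DualNumber A :=
  pt (Q k) (if k = 0 then 0 else killing D r Q k)

lemma mk_flow (D : Derivation ℚ A A) (r : ℕ) {Q : ℕ → A} (h0 : Q 0 = 1) :
    mk (flow D r Q) = ptS (mk Q) (killS D r (mk Q)) := by
  ext k
  · simp [flow]
  · rw [coeff_ptS, PowerSeries.coeff_mk, flow, snd_pt, snd_pt]
    split_ifs with h
    · rw [h, killS]; simp
    · exact killing_eq_coeff D r h0 (by omega)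

lemma flow_zero (D : Derivation ℚ A A) (r : ℕ) {Q : ℕ → A} (h0 : Q 0 = 1) :
    flow D r Q 0 = 1 := by
  rw [flow, h0, if_pos rfl, pt_one_zero]

lemma killing_flow_comm (D : Derivation ℚ A A) {i j : ℕ} (hi : 1 ≤ i) (hj : 1 ≤ j) {Q : ℕ → A}
    (h0 : Q 0 = 1) {l : ℕ} (hl : 1 ≤ l) :
    (killing (dualD D) j (flow D i Q) l).snd = (killing (dualD D) i (flow D j Q) l).snd := by
  rw [killing_eq_coeff _ _ (flow_zero D i h0) hl, killing_eq_coeff _ _ (flow_zero D j h0) hl,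
    mk_flow D i h0, mk_flow D j h0, killS_comm D hi hj]

end Commute

/-! ### Triangular systems -/

section Recursion

variable {α : Type*} (Pr : ℕ → (ℕ → α) → Prop)

lemma exists_seq_of_triangular [Inhabited α]
    (hloc : ∀ k f g, (∀ i ≤ k, f i = g i) → Pr k f → Pr k g)
    (hex : ∀ k f, (∀ j < k, Pr j f) → ∃ c, Pr k (Function.update f k c)) :
    ∃ f, ∀ k, Pr k f := by
  classical
  -- The hypothesis is moved inside the existential so that the choice is defined for every f and
  -- can drive an unconditional recursion.
  have step : ∀ k (f : ℕ → α), ∃ c, (∀ j < k, Pr j f) → Pr k (Function.update f k c) := by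
    intro k f
    by_cases h : ∀ j < k, Pr j f
    · obtain ⟨c, hc⟩ := hex k f h
      exact ⟨c, fun _ => hc⟩
    · exact ⟨default, fun h' => absurd h' h⟩
  choose c hc using step
  let F : ℕ → ℕ → α := fun n => Nat.rec (fun _ => default) (fun k f => Function.update f k (c k f)) n
  have hF : ∀ n, F (n + 1) = Function.update (F n) n (c n (F n)) := fun _ => rfl
  have hstab : ∀ i n, i < n → F n i = F (i + 1) i := by
    intro i n h
    induction n with
    | zero => omega
    | succ n ih =>
      rcases Nat.lt_succ_iff_lt_or_eq.1 h with h | rfl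
      · rw [hF n, Function.update_of_ne (by omega), ih h]
      · rfl
  have hall : ∀ n, ∀ k < n, Pr k (F n) := by
    intro n
    induction n with
    | zero => intro k hk; omega
    | succ n ih =>
      intro k hk
      rcases Nat.lt_succ_iff_lt_or_eq.1 hk with h | rfl
      · refine hloc k (F n) _ (fun i hi => ?_) (ih k h)
        rw [hF n, Function.update_of_ne (by omega)]
      · exact hc k (F k) ih
  refine ⟨fun k => F (k + 1) k, fun k => hloc k (F (k + 1)) _ (fun i hi => ?_)
    (hall (k + 1) k (by omega))⟩
  exact hstab i (k + 1) (by omega)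

/-- The bound K allows sequences that satisfy only finitely many conditions: points with n
coordinates, or flows that have lost some orders. -/
lemma seq_unique_of_triangular
    (hloc : ∀ k f g, (∀ i ≤ k, f i = g i) → Pr k f → Pr k g)
    (huniq : ∀ k f, (∀ j < k, Pr j f) → ∀ c c', Pr k (Function.update f k c) →
      Pr k (Function.update f k c') → c = c') {K : ℕ} {f g : ℕ → α}
    (hf : ∀ k < K, Pr k f) (hg : ∀ k < K, Pr k g) : ∀ k < K, f k = g k := by
  intro k
  induction k using Nat.strong_induction_on with
  | _ k ih =>
    intro hk
    refine huniq k f (fun j hj => hf j (by omega)) (f k) (g k) ?_ ?_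
    · rw [Function.update_eq_self]
      exact hf k hk
    · refine hloc k g _ (fun i hi => ?_) (hg k hk)
      rcases Nat.lt_or_eq_of_le hi with h | rfl
      · rw [Function.update_of_ne h.ne, ih i h (by omega)]
      · rw [Function.update_self]

end Recursion

/-! ### Potentials and Lagrangians as coefficients of power series -/

section Potentials

variable {A : Type u} [CommRing A] [Algebra ℚ A]

/-- The recursion is long division by F: each step splits off the constant term d_k of W_k / F and
divides the remainder by `X`. -/
lemma coeff_of_recursion {W : ℕ → A⟦X⟧} {d : ℕ → A} {F : A⟦X⟧} (hF : IsUnit F)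
    (h : ∀ k, W k = X * W (k + 1) + C (d k) * F) (k : ℕ) :
    d k = coeff k (W 0 * Ring.inverse F) := by
  have h' : ∀ k, W k * Ring.inverse F = X * (W (k + 1) * Ring.inverse F) + C (d k) := fun k => by
    rw [h k]
    linear_combination C (d k) * Ring.mul_inverse_cancel F hF
  induction k generalizing W d with
  | zero => rw [h']; simp
  | succ k ih =>
    rw [h', map_add, PowerSeries.coeff_succ_X_mul, PowerSeries.coeff_succ_C, add_zero]
    exact ih (W := fun k => W (k + 1)) (d := fun k => d (k + 1)) (fun k => h (k + 1))
      fun k => h' (k + 1)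

/-- The sequence of the coefficients of `λ ^ n + q_1 λ ^ (n - 1) + ⋯ + q_n`, by powers of `λ`. -/
def rev {n : ℕ} (q : Fin n → A) (k : ℕ) : A := if k ≤ n then coord q (n - k) else 0

/-- The monomial sum `∑ v_i X ^ (e_i)`. -/
noncomputable def vecS {n : ℕ} (e : Fin n → ℕ) (v : Fin n → A) : A⟦X⟧ := ∑ i, C (v i) * X ^ e i

@[simp] lemma coord_zero {n : ℕ} (q : Fin n → A) : coord q 0 = 1 := rfl

lemma coord_of_lt {n : ℕ} (q : Fin n → A) {k : ℕ} (h : n < k) : coord q k = 0 := by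
  rw [coord, if_neg (by omega), dif_neg (by omega)]

@[simp] lemma coord_succ {n : ℕ} (q : Fin n → A) (i : Fin n) : coord q (i + 1) = q i := by
  rw [coord, if_neg (by omega), dif_pos (by simp)]
  simp

lemma coord_of_pos {n : ℕ} (q : Fin n → A) {k : ℕ} (h1 : 1 ≤ k) (h2 : k ≤ n) :
    coord q k = q ⟨k - 1, by omega⟩ := by
  rw [← coord_succ q ⟨k - 1, by omega⟩]
  congr
  simp only
  omega

lemma mk_coord {n : ℕ} (q : Fin n → A) :
    mk (coord q) = 1 + vecS (fun i => (i : ℕ) + 1) q := by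
  ext k
  rw [vecS, map_add, map_sum, PowerSeries.coeff_mk, PowerSeries.coeff_one]
  simp only [PowerSeries.coeff_C_mul_X_pow]
  rcases Nat.eq_zero_or_pos k with rfl | hk
  · simp
  · rw [if_neg (by omega), zero_add]
    rcases lt_or_ge n k with h | h
    · rw [coord_of_lt q h, Finset.sum_eq_zero]
      intro i _
      rw [if_neg (by omega)]
    · rw [coord_of_pos q hk h, Finset.sum_eq_single ⟨k - 1, by omega⟩]
      · rw [if_pos (by simp only; omega)]
      · intro i _ hi
        rw [if_neg]
        rintro rfl
        exact hi (by ext; simp)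
      · simp

lemma mk_rev {n : ℕ} (q : Fin n → A) :
    mk (rev q) = X ^ n + vecS (fun i => n - 1 - (i : ℕ)) q := by
  ext k
  rw [vecS, map_add, map_sum, PowerSeries.coeff_mk, PowerSeries.coeff_X_pow, rev]
  simp only [PowerSeries.coeff_C_mul_X_pow]
  rcases lt_or_ge k n with hk | hk
  · rw [if_pos hk.le, if_neg hk.ne, zero_add, coord_of_pos q (by omega) (by omega),
      Finset.sum_eq_single ⟨n - k - 1, by omega⟩]
    · rw [if_pos (by simp only; omega)]
    · intro i _ hi
      rw [if_neg]
      rintro h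
      exact hi (by ext; simp only; omega)
    · simp
  · rw [Finset.sum_eq_zero, add_zero]
    · rcases Nat.lt_or_eq_of_le hk with h | rfl
      · rw [if_neg (by omega), if_neg (by omega)]
      · simp
    · intro i _
      rw [if_neg (by omega)]

lemma isUnit_mk {Q : ℕ → A} (h : IsUnit (Q 0)) : IsUnit (mk Q) := by
  rw [PowerSeries.isUnit_iff_constantCoeff]
  simpa using h

lemma isUnit_mk_coord {n : ℕ} (q : Fin n → A) : IsUnit (mk (coord q)) :=
  isUnit_mk (by rw [coord_zero]; exact isUnit_one)

lemma rev_zero {n : ℕ} (q : Fin n → A) : rev q 0 = coord q n := by simp [rev]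

lemma potPos_of_lt {n : ℕ} (q : Fin n → A) (k : ℕ) {i : ℕ} (h : n < i) : potPos q k i = 0 := by
  cases k with
  | zero => rw [potPos, if_neg (by omega)]
  | succ k => rw [potPos, if_neg (by omega)]

/-- The series V_1^(k) + V_2^(k) X + … are the successive remainders of X^(n-1) under division by f.
-/
lemma potPos_one {n : ℕ} (hn : 1 ≤ n) (q : Fin n → A) (k : ℕ) :
    potPos q k 1 = coeff k (X ^ (n - 1) * Ring.inverse (mk (coord q))) := by
  have h0 : (mk fun m => potPos q 0 (m + 1)) = X ^ (n - 1) := by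
    ext m
    rw [PowerSeries.coeff_mk, PowerSeries.coeff_X_pow, potPos]
    exact if_congr (by omega) rfl rfl
  rw [← h0]
  refine coeff_of_recursion (W := fun k => mk fun m => potPos q k (m + 1))
    (d := fun k => potPos q k 1) (isUnit_mk_coord q) (fun k => ?_) k
  ext m
  rw [map_add, PowerSeries.coeff_C_mul, PowerSeries.coeff_mk, PowerSeries.coeff_mk]
  cases m with
  | zero => simp
  | succ m =>
    rw [PowerSeries.coeff_succ_X_mul, PowerSeries.coeff_mk, potPos]
    split_ifs with h
    · ring
    · rw [potPos_of_lt q k (by omega), coord_of_lt q (by omega)]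
      ring

lemma potNeg_zero_right {n : ℕ} (hn : 1 ≤ n) (q : Fin n → A) (k : ℕ) : potNeg q k 0 = 0 := by
  cases k with
  | zero => rw [potNeg, if_neg (by omega)]
  | succ k => rw [potNeg, if_neg (by omega)]

/-- The reversed recursion divides 1 by P, the remainders being V_n^(-k) + V_{n-1}^(-k) X + … and
the digits V_n^(-k) / q_n. The step to V_1 has V_0 = 0 and q_0 = 1, so it yields minus the digit. -/
lemma potNeg_one {n : ℕ} (hn : 1 ≤ n) (q : Fin n → A) (hq : IsUnit (coord q n)) (k : ℕ) :
    potNeg q (k + 1) 1 = -coeff k (Ring.inverse (mk (rev q))) := by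
  have h0 : (mk fun m => if m < n then potNeg q 0 (n - m) else 0) = (1 : A⟦X⟧) := by
    ext m
    rw [PowerSeries.coeff_mk, PowerSeries.coeff_one]
    split_ifs with h1 h2 h2
    · rw [potNeg, if_pos (by omega)]
    · rw [potNeg, if_neg (by omega)]
    · omega
    · rfl
  have key := coeff_of_recursion (W := fun k => mk fun m => if m < n then potNeg q k (n - m) else 0)
    (d := fun k => Ring.inverse (coord q n) * potNeg q k n)
    (isUnit_mk (Q := rev q) (by rwa [rev_zero])) (fun k => ?_) k
  · rw [h0, one_mul] at key
    rw [← key, potNeg, if_pos ⟨le_rfl, hn⟩, potNeg_zero_right hn]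
    simp
  · ext m
    rw [map_add, PowerSeries.coeff_C_mul, PowerSeries.coeff_mk, PowerSeries.coeff_mk]
    cases m with
    | zero =>
      rw [if_pos (by omega), PowerSeries.coeff_zero_X_mul, rev_zero, Nat.sub_zero]
      linear_combination (-potNeg q k n) * Ring.mul_inverse_cancel _ hq
    | succ m =>
      rw [PowerSeries.coeff_succ_X_mul, PowerSeries.coeff_mk, rev]
      by_cases h : m < n
      · rw [if_pos (show m < n from h), if_pos (show m + 1 ≤ n from h), potNeg,
          if_pos (show 1 ≤ n - m ∧ n - m ≤ n by omega), show n - m - 1 = n - (m + 1) by omega]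
        split_ifs with h'
        · ring
        · rw [show n - (m + 1) = 0 by omega, potNeg_zero_right hn]
          ring
      · rw [if_neg (by omega), if_neg h, if_neg (by omega)]
        ring

lemma coeff_vecS_sq_mul {n : ℕ} (e : Fin n → ℕ) (v : Fin n → A) (F : A⟦X⟧) (K : ℕ) :
    coeff K (vecS e v ^ 2 * F) = ∑ i, ∑ j, v i * coeff K (X ^ (e i + e j) * F) * v j := by
  rw [vecS, pow_two, Finset.sum_mul_sum, Finset.sum_mul, map_sum]
  refine Finset.sum_congr rfl fun i _ => ?_
  rw [Finset.sum_mul, map_sum]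
  refine Finset.sum_congr rfl fun j _ => ?_
  have h : C (v i) * X ^ e i * (C (v j) * X ^ e j) * F
      = C (v i) * (C (v j) * (X ^ (e i + e j) * F)) := by ring
  rw [h, PowerSeries.coeff_C_mul, PowerSeries.coeff_C_mul]
  ring

lemma coeffD_vecS (D : Derivation ℚ A A) {n : ℕ} (e : Fin n → ℕ) (v : Fin n → A) :
    coeffD D (vecS e v) = vecS e fun j => D (v j) := by
  ext k
  rw [coeff_coeffD, vecS, vecS, map_sum, map_sum, map_sum]
  refine Finset.sum_congr rfl fun i _ => ?_
  rw [PowerSeries.coeff_C_mul_X_pow, PowerSeries.coeff_C_mul_X_pow]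
  split_ifs <;> simp

lemma vecS_pt {n : ℕ} (e : Fin n → ℕ) (v w : Fin n → A) :
    vecS e (fun j => pt (v j) (w j)) = ptS (vecS e v) (vecS e w) := by
  ext k
  all_goals
    simp only [vecS, map_sum, coeff_ptS, PowerSeries.coeff_C_mul_X_pow, fst_sum, snd_sum,
      fst_pt, snd_pt]
    refine Finset.sum_congr rfl fun i _ => ?_
    split_ifs <;> simp

lemma vecS_zero {n : ℕ} (e : Fin n → ℕ) : vecS e (fun _ => (0 : A)) = 0 := by
  simp [vecS]

lemma vecS_single {n : ℕ} (e : Fin n → ℕ) (i : Fin n) :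
    vecS e (fun j => if j = i then (1 : A) else 0) = X ^ e i := by
  rw [vecS, Finset.sum_eq_single i]
  · simp
  · intro j _ hj
    simp [hj]
  · simp

lemma mk_coord_pt {n : ℕ} (q w : Fin n → A) :
    mk (coord fun j => pt (q j) (w j)) = ptS (mk (coord q)) (vecS (fun i => (i : ℕ) + 1) w) := by
  rw [mk_coord, mk_coord, vecS_pt, ← ptS_one, ptS_add, zero_add]

lemma mk_rev_pt {n : ℕ} (q w : Fin n → A) :
    mk (rev fun j => pt (q j) (w j)) = ptS (mk (rev q)) (vecS (fun i => n - 1 - (i : ℕ)) w) := by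
  rw [mk_rev, mk_rev, vecS_pt, ← ptS_X_pow, ptS_add, zero_add]

/-- The Lagrangian of the nonlocal hierarchy. -/
lemma lagrangian_nonlocal {n : ℕ} (hn : 1 ≤ n) (N : ℕ) (e : ℚ) (q v : Fin n → A) :
    lagrangian (-(N : ℤ)) 0 e q v = (1 / 4 : ℚ) • coeff (2 * n + N)
      (vecS (fun i => (i : ℕ) + 1) v ^ 2 * (X ^ (n - 1) * Ring.inverse (mk (coord q))))
      - (e / 4) • (if 1 = n then 1 else 0) := by
  rw [lagrangian, coeff_vecS_sq_mul]
  congr 2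
  refine Finset.sum_congr rfl fun i _ => Finset.sum_congr rfl fun j _ => ?_
  have h : 2 * (n : ℤ) - (-(N : ℤ)) - ((i : ℕ) + 1) - ((j : ℕ) + 1)
      = Int.ofNat (2 * n + N - ((i : ℕ) + 1 + ((j : ℕ) + 1))) := by
    rw [Int.ofNat_eq_natCast]
    omega
  rw [metric, h, pot, potPos_one hn, PowerSeries.coeff_X_pow_mul' _ _ (2 * n + N), if_pos (by omega)]

/-- The Lagrangian of the local hierarchy. -/
lemma lagrangian_local {N n : ℕ} (hn : N < n) (e : ℚ) (q v : Fin n → A)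
    (hq : IsUnit (coord q n)) :
    lagrangian ((n : ℤ) - N) (-(n : ℤ)) e q v = (1 / 4 : ℚ) • (coeff (n + N)
      (vecS (fun i => (i : ℕ) + 1) v ^ 2 * (X ^ (n - 1) * Ring.inverse (mk (coord q))))
      - coeff (n - 1 - N) (vecS (fun i => n - 1 - (i : ℕ)) v ^ 2 * Ring.inverse (mk (rev q))))
      + (e / 4) • coeff (n - 1) (Ring.inverse (mk (rev q))) := by
  have hk : pot q (-(n : ℤ)) 1 = -coeff (n - 1) (Ring.inverse (mk (rev q))) := by
    rw [show -(n : ℤ) = Int.negSucc (n - 1) by omega, pot, potNeg_one (by omega) q hq]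
  rw [lagrangian, hk, smul_neg, sub_neg_eq_add, coeff_vecS_sq_mul, coeff_vecS_sq_mul]
  congr 2
  simp only [← Finset.sum_sub_distrib]
  refine Finset.sum_congr rfl fun i _ => Finset.sum_congr rfl fun j _ => ?_
  rw [← sub_mul, ← mul_sub, metric]
  congr 2
  rw [PowerSeries.coeff_X_pow_mul' _ _ (n + N), PowerSeries.coeff_X_pow_mul' _ _ (n - 1 - N)]
  -- The sign of the index of V_1 decides between the expansion at λ = ∞ and the one at λ = 0. For
  -- each entry the other coefficient vanishes.
  by_cases h : (i : ℕ) + 1 + ((j : ℕ) + 1) ≤ n + N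
  · have h' : 2 * (n : ℤ) - ((n : ℤ) - N) - ((i : ℕ) + 1) - ((j : ℕ) + 1)
        = Int.ofNat (n + N - ((i : ℕ) + 1 + ((j : ℕ) + 1))) := by
      rw [Int.ofNat_eq_natCast]
      omega
    rw [h', pot, potPos_one (by omega), if_pos h, if_neg (by omega), sub_zero]
  · have h' : 2 * (n : ℤ) - ((n : ℤ) - N) - ((i : ℕ) + 1) - ((j : ℕ) + 1)
        = Int.negSucc ((i : ℕ) + 1 + ((j : ℕ) + 1) - (n + N) - 1) := by
      omega
    rw [h', pot, potNeg_one (by omega) q hq, if_neg h, if_pos (by omega), zero_sub,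
      show n - 1 - N - (n - 1 - (i : ℕ) + (n - 1 - (j : ℕ)))
        = (i : ℕ) + 1 + ((j : ℕ) + 1) - (n + N) - 1 by omega]

lemma snd_coeff_ptS (f g : A⟦X⟧) (k : ℕ) : (coeff k (ptS f g)).snd = coeff k g := by simp

lemma coeffD_mk_coord (D : Derivation ℚ A A) {n : ℕ} (q : Fin n → A) :
    coeffD D (mk (coord q)) = vecS (fun i => (i : ℕ) + 1) fun j => D (q j) := by
  rw [mk_coord, map_add, Derivation.map_one_eq_zero, zero_add, coeffD_vecS]

lemma coeffD_mk_rev (D : Derivation ℚ A A) {n : ℕ} (q : Fin n → A) :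
    coeffD D (mk (rev q)) = vecS (fun i => n - 1 - (i : ℕ)) fun j => D (q j) := by
  rw [mk_rev, map_add, coeffD_X_pow, zero_add, coeffD_vecS]

/-- The Euler–Lagrange expression of `f ↦ coeff K (X ^ s * f_x ^ 2 / f)` under variation of the
coefficient of `X ^ d`. -/
lemma variation_sq_div (D : Derivation ℚ A A) {f : A⟦X⟧} (hf : IsUnit f) (s d K : ℕ) :
    (coeff K (ptS (coeffD D f) 0 ^ 2 * (X ^ s * Ring.inverse (ptS f (X ^ d))))).snd
      - D (coeff K (ptS (coeffD D f) (X ^ d) ^ 2 * (X ^ s * Ring.inverse (ptS f 0)))).snd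
      = coeff K (X ^ (s + d) * schw D f) := by
  rw [inverse_ptS hf, inverse_ptS hf, ← ptS_X_pow, pow_two (ptS _ _), pow_two (ptS _ (X ^ d)), ptS_mul, ptS_mul, ptS_mul,
    ptS_mul, ptS_mul, ptS_mul, snd_coeff_ptS, snd_coeff_ptS, ← coeff_coeffD, ← map_sub]
  congr 1
  have e : (coeffD D f * coeffD D f) * (X ^ s * -(0 * Ring.inverse f ^ 2) + 0 * Ring.inverse f)
      + (coeffD D f * X ^ d + X ^ d * coeffD D f) * (X ^ s * Ring.inverse f)
      = X ^ (s + d) * (2 * logD D f) := by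
    rw [logD]
    ring
  rw [e, coeffD_X_pow_mul, coeffD_mul, coeffD_two, schw, logD]
  ring

/-- The elimination equations of the nonlocal hierarchy. -/
lemma eulerLagrange_nonlocal (D : Derivation ℚ A A) {n : ℕ} (N : ℕ) (e : ℚ) (q : Fin n → A)
    (i : Fin n) :
    eulerLagrange D (-(N : ℤ)) 0 e q i = (1 / 4 : ℚ) • coeff (n + N - i) (schw D (mk (coord q))) := by
  have hn : 1 ≤ n := by have := i.2; omega
  -- The potential V_1^(0) is the constant δ_{1n}, so it has no variation.
  have h : ∀ P : Prop, ∀ [Decidable P], (if P then (1 : DualNumber A) else 0).snd = 0 := by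
    intro P _
    split_ifs <;> simp
  have key := variation_sq_div D (isUnit_mk_coord q) (n - 1) (i + 1) (2 * n + N)
  rw [PowerSeries.coeff_X_pow_mul', if_pos (by omega),
    show 2 * n + N - (n - 1 + (i + 1)) = n + N - i by omega] at key
  rw [eulerLagrange, lagrangian_nonlocal hn, lagrangian_nonlocal hn]
  simp only [mk_coord_pt, vecS_pt, vecS_zero, vecS_single, ← coeffD_mk_coord, snd_sub, snd_smul, h,
    smul_zero, sub_zero, Derivation.map_smul, ← smul_sub]
  rw [key]

/-- The coefficients by which the non-negative part of `4 λ ^ N U` at `λ = ∞` enters. -/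
noncomputable def polyPart (D : Derivation ℚ A A) (N : ℕ) (f : A⟦X⟧) : A⟦X⟧ :=
  mk fun k => if k ≤ N then coeff (N - k) (schw D f) else 0

/-- The elimination equations of the local hierarchy. -/
lemma eulerLagrange_local (D : Derivation ℚ A A) {N n : ℕ} (q : Fin n → A)
    (hq : IsUnit (coord q n)) (i : Fin n) (hi : (i : ℕ) + N < n) :
    eulerLagrange D ((n : ℤ) - N) (-(n : ℤ)) (-1) q i = (1 / 4 : ℚ) •
      coeff i (polyPart D N (mk (coord q)) - X ^ N * schw D (mk (rev q))
        + Ring.inverse (mk (rev q)) ^ 2) := by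
  have hu : IsUnit (mk (rev q)) := isUnit_mk (by rwa [rev_zero])
  have hn : N < n := by omega
  have hc : ∀ w : Fin n → A, IsUnit (coord (fun j => pt (q j) (w j)) n) := fun w => by
    rw [coord_of_pos _ (by omega) le_rfl] at hq ⊢
    rw [isUnit_iff_isUnit_fst, fst_pt]
    exact hq
  have k1 := variation_sq_div D (isUnit_mk_coord q) (n - 1) (i + 1) (n + N)
  have k2 := variation_sq_div D hu 0 (n - 1 - i) (n - 1 - N)
  rw [eulerLagrange, lagrangian_local hn _ _ _ (hc _), lagrangian_local hn _ _ _ (hc _)]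
  simp only [pow_zero, one_mul, zero_add] at k2
  -- Varying the potential V_1^(-n), a coefficient of -1/P, is the source of the term P⁻².
  have k3 : (coeff (n - 1) (Ring.inverse (ptS (mk (rev q)) (X ^ (n - 1 - (i : ℕ)))))).snd
      = -coeff i (Ring.inverse (mk (rev q)) ^ 2) := by
    rw [inverse_ptS hu, snd_coeff_ptS, map_neg, PowerSeries.coeff_X_pow_mul', if_pos (by omega),
      show n - 1 - (n - 1 - (i : ℕ)) = i by omega]
  have k4 : (coeff (n - 1) (Ring.inverse (ptS (mk (rev q)) 0))).snd = 0 := by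
    rw [inverse_ptS hu, snd_coeff_ptS]
    simp
  simp only [mk_coord_pt, mk_rev_pt, vecS_pt, vecS_zero, vecS_single, ← coeffD_mk_coord,
    ← coeffD_mk_rev, snd_sub, snd_add, snd_smul, k3, k4, smul_zero, add_zero, Derivation.map_smul,
    map_sub]
  rw [polyPart, map_add, map_sub, PowerSeries.coeff_mk, PowerSeries.coeff_X_pow_mul']
  have k5 : (if (i : ℕ) ≤ N then coeff (N - i) (schw D (mk (coord q))) else 0)
      = coeff (n + N) (X ^ (n - 1 + (i + 1)) * schw D (mk (coord q))) := by
    rw [PowerSeries.coeff_X_pow_mul']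
    refine if_ctx_congr (by omega) (fun _ => ?_) (fun _ => rfl)
    rw [show n + N - (n - 1 + (i + 1)) = N - i by omega]
  have k6 : (if N ≤ (i : ℕ) then coeff (i - N) (schw D (mk (rev q))) else 0)
      = coeff (n - 1 - N) (X ^ (n - 1 - (i : ℕ)) * schw D (mk (rev q))) := by
    rw [PowerSeries.coeff_X_pow_mul']
    refine if_ctx_congr (by omega) (fun _ => ?_) (fun _ => rfl)
    rw [show n - 1 - N - (n - 1 - (i : ℕ)) = i - N by omega]
  rw [k5, k6, ← k1, ← k2]
  module

end Potentials

/-! ### Triangular dependence of `schw` on the coefficients of the series. -/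

section Triangular

variable {A : Type u} [CommRing A] [Algebra ℚ A]

lemma eq_zero_of_two_mul_eq_zero {a : A} (h : 2 * a = 0) : a = 0 := by
  have h2 : (2 : ℚ) • a = 0 := by rw [← h, two_smul, two_mul]
  exact (smul_eq_zero_iff_right (two_ne_zero' ℚ)).1 h2

lemma two_mul_half_smul (a : A) : 2 * ((1 / 2 : ℚ) • a) = a := by
  rw [two_mul, ← add_smul]
  norm_num

lemma quarter_smul_eq_zero {a : A} : (1 / 4 : ℚ) • a = 0 ↔ a = 0 :=
  smul_eq_zero_iff_right (by norm_num)

lemma X_pow_dvd_mk_sub_mk {f g : ℕ → A} {K : ℕ} :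
    X ^ K ∣ mk f - mk g ↔ ∀ k < K, f k = g k := by
  simp [PowerSeries.X_pow_dvd_iff, sub_eq_zero]

lemma X_pow_dvd_coeffD (D : Derivation ℚ A A) {K : ℕ} {f : A⟦X⟧} (h : X ^ K ∣ f) :
    X ^ K ∣ coeffD D f := by
  obtain ⟨g, rfl⟩ := h
  exact ⟨coeffD D g, coeffD_X_pow_mul D K g⟩

lemma X_pow_dvd_inverse_sub_inverse {f g : A⟦X⟧} (hf : IsUnit f) (hg : IsUnit g) {K : ℕ}
    (h : X ^ K ∣ f - g) : X ^ K ∣ Ring.inverse f - Ring.inverse g := by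
  have e : Ring.inverse f - Ring.inverse g = (f - g) * -(Ring.inverse f * Ring.inverse g) := by
    linear_combination (Ring.inverse g) * (Ring.mul_inverse_cancel f hf)
      - (Ring.inverse f) * (Ring.mul_inverse_cancel g hg)
  rw [e]
  exact h.mul_right _

lemma X_pow_dvd_logD_sub_logD (D : Derivation ℚ A A) {f g : A⟦X⟧} (hf : IsUnit f) (hg : IsUnit g)
    {K : ℕ} (h : X ^ K ∣ f - g) : X ^ K ∣ logD D f - logD D g := by
  have e : logD D f - logD D g = coeffD D (f - g) * Ring.inverse f
      + coeffD D g * (Ring.inverse f - Ring.inverse g) := by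
    rw [logD, logD, map_sub]
    ring
  rw [e]
  exact dvd_add ((X_pow_dvd_coeffD D h).mul_right _)
    ((X_pow_dvd_inverse_sub_inverse hf hg h).mul_left _)

lemma X_pow_dvd_schw_sub_schw (D : Derivation ℚ A A) {f g : A⟦X⟧} (hf : IsUnit f) (hg : IsUnit g)
    {K : ℕ} (h : X ^ K ∣ f - g) : X ^ K ∣ schw D f - schw D g := by
  have e : schw D f - schw D g = -2 * coeffD D (logD D f - logD D g)
      - (logD D f + logD D g) * (logD D f - logD D g) := by
    rw [schw, schw, map_sub]
    ring
  have h' := X_pow_dvd_logD_sub_logD D hf hg h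
  rw [e]
  exact dvd_sub ((X_pow_dvd_coeffD D h').mul_left _) (h'.mul_left _)

/-- The coefficients of `schw` of degree at most `k` depend on those of the series only. -/
lemma coeff_schw_congr (D : Derivation ℚ A A) {f g : ℕ → A} {k : ℕ} (h : ∀ i ≤ k, f i = g i) :
    coeff k (schw D (mk f)) = coeff k (schw D (mk g)) := by
  by_cases hf : IsUnit (f 0)
  · have hg : IsUnit (g 0) := by rwa [← h 0 (Nat.zero_le k)]
    have h' := X_pow_dvd_schw_sub_schw D (isUnit_mk hf) (isUnit_mk hg) (K := k + 1)
      (X_pow_dvd_mk_sub_mk.2 fun i hi => h i (by omega))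
    rw [PowerSeries.X_pow_dvd_iff] at h'
    rw [← sub_eq_zero, ← map_sub]
    exact h' k (by omega)
  -- For a non-unit, `Ring.inverse` is 0 and `schw` vanishes. The lemma thus holds for arbitrary
  -- sequences, as locality in the triangular scheme requires.
  · have hz : ∀ q : ℕ → A, ¬IsUnit (q 0) → schw D (mk q) = 0 := fun q hq => by
      rw [schw, logD, Ring.inverse_non_unit]
      · simp
      · rwa [PowerSeries.isUnit_iff_constantCoeff, PowerSeries.constantCoeff_mk]
    rw [hz f hf, hz g (by rwa [← h 0 (Nat.zero_le k)])]

lemma mk_update (f : ℕ → A) (k : ℕ) (c : A) :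
    mk (Function.update f k c) = mk (Function.update f k 0) + C c * X ^ k := by
  ext m
  rw [map_add, PowerSeries.coeff_C_mul_X_pow, PowerSeries.coeff_mk, PowerSeries.coeff_mk,
    Function.update_apply, Function.update_apply]
  split_ifs <;> simp

lemma coeff_zero_mul (f g : A⟦X⟧) : coeff 0 (f * g) = coeff 0 f * coeff 0 g := by
  simp only [PowerSeries.coeff_zero_eq_constantCoeff_apply, map_mul]

lemma coeff_zero_logD (D : Derivation ℚ A A) {f : A⟦X⟧} (h : coeff 0 f = 1) :
    coeff 0 (logD D f) = 0 := by
  rw [logD, coeff_zero_mul, coeff_coeffD, h, Derivation.map_one_eq_zero, zero_mul]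

/-- The coefficient of `X ^ M` in `schw` is triangular in that of the series. -/
lemma coeff_schw_add_monomial (D : Derivation ℚ A A) {f : A⟦X⟧} (h0 : coeff 0 f = 1) (c : A) {M : ℕ}
    (hM : 1 ≤ M) :
    coeff M (schw D (f + C c * X ^ M)) = coeff M (schw D f) - 2 * D (D c) := by
  have hX : coeff 0 (X ^ M : A⟦X⟧) = 0 := by rw [PowerSeries.coeff_X_pow, if_neg (by omega)]
  have hf : IsUnit f := by
    rw [PowerSeries.isUnit_iff_constantCoeff, ← PowerSeries.coeff_zero_eq_constantCoeff_apply, h0]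
    exact isUnit_one
  have hg : IsUnit (f + C c * X ^ M) := by
    rw [PowerSeries.isUnit_iff_constantCoeff, ← PowerSeries.coeff_zero_eq_constantCoeff_apply,
      map_add, PowerSeries.coeff_C_mul, hX, h0, mul_zero, add_zero]
    exact isUnit_one
  obtain ⟨e, he⟩ := X_pow_dvd_logD_sub_logD D hg hf (K := M) ⟨C c, by ring⟩
  have hw : logD D (f + C c * X ^ M) = logD D f + X ^ M * e := by rw [← he]; ring
  have h1 := coeffD_eq_logD_mul D hf
  have h2 := coeffD_eq_logD_mul D hg
  have hc : coeffD D (C c) = C (D c) := by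
    ext m
    rw [coeff_coeffD, PowerSeries.coeff_C, PowerSeries.coeff_C]
    split_ifs <;> simp
  rw [hw, map_add, h1, coeffD_mul, coeffD_X_pow, hc] at h2
  have h3 : X ^ M * C (D c) = X ^ M * (e * (f + C c * X ^ M) + logD D f * C c) := by
    linear_combination h2
  have h4 := PowerSeries.X_pow_mul_cancel h3
  have hw0 := coeff_zero_logD D h0
  -- In h4 the other terms drop out at order zero: f starts with 1, so `logD D f` has no constant
  -- term, and M ≥ 1.
  have he0 : coeff 0 e = D c := by
    have := congrArg (coeff 0) h4
    simp only [map_add, coeff_zero_mul, hX, h0, hw0, PowerSeries.coeff_zero_C] at this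
    rw [this]
    ring
  have hs : schw D (f + C c * X ^ M) = schw D f
      + X ^ M * (-(2 * coeffD D e) - 2 * logD D f * e - X ^ M * e ^ 2) := by
    rw [schw, schw, hw, map_add, coeffD_X_pow_mul]
    ring
  have h20 : coeff 0 (2 : A⟦X⟧) = 2 := by
    rw [← map_ofNat (C (R := A)) 2, PowerSeries.coeff_zero_C]
  rw [hs, map_add, PowerSeries.coeff_X_pow_mul', if_pos le_rfl, Nat.sub_self]
  simp only [map_sub, map_neg, coeff_zero_mul, hX, hw0, coeff_coeffD, he0, h20]
  ring

end Triangular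

/-! ### The nonlocal elimination -/

section Nonlocal

variable {A : Type u} [CommRing A] [Algebra ℚ A]

/-- As 1 need not lie in V, the entry q_0 = 1 is treated apart: f_x = w f gives w_k as (q_k)_x minus
products of earlier w's and later q's, all in V. -/
lemma coeff_schw_mem (D : Derivation ℚ A A) {V : NonUnitalSubalgebra ℚ A} (hD : ∀ a ∈ V, D a ∈ V)
    {Q : ℕ → A} (h0 : Q 0 = 1) (hQ : ∀ k, 1 ≤ k → Q k ∈ V) (k : ℕ) :
    coeff k (schw D (mk Q)) ∈ V := by
  have hQ' : ∀ k, D (Q k) ∈ V := fun k => by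
    rcases Nat.eq_zero_or_pos k with rfl | hk
    · rw [h0, Derivation.map_one_eq_zero]
      exact V.zero_mem
    · exact hD _ (hQ k hk)
  have hu : IsUnit (mk Q) := isUnit_mk (by rw [h0]; exact isUnit_one)
  have hw : ∀ k, coeff k (logD D (mk Q)) ∈ V := by
    intro k
    induction k using Nat.strong_induction_on with
    | _ k ih =>
      have h := congrArg (coeff k) (coeffD_eq_logD_mul D hu)
      rw [PowerSeries.coeff_mul, coeff_coeffD, PowerSeries.coeff_mk] at h
      cases k with
      | zero =>
        rw [coeff_zero_logD D (by rw [PowerSeries.coeff_mk, h0])]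
        exact V.zero_mem
      | succ k =>
        rw [Finset.Nat.sum_antidiagonal_succ', PowerSeries.coeff_mk, h0, mul_one] at h
        rw [← sub_eq_iff_eq_add] at h
        rw [← h]
        refine V.sub_mem (hQ' _) (V.sum_mem fun p hp => ?_)
        have hp := Finset.HasAntidiagonal.mem_antidiagonal.1 hp
        rw [PowerSeries.coeff_mk]
        exact V.mul_mem (ih _ (by omega)) (hQ _ (by omega))
  rw [schw, map_sub, map_neg, two_mul, map_add, coeff_coeffD, pow_two, PowerSeries.coeff_mul]
  exact V.sub_mem (V.neg_mem (V.add_mem (hD _ (hw k)) (hD _ (hw k))))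
    (V.sum_mem fun p _ => V.mul_mem (hw _) (hw _))

/-- The `k`-th condition on a sequence that solves the nonlocal elimination equations. -/
def NonlocalAt (D : Derivation ℚ A A) (V : Set A) {N : ℕ} (q : Fin N → A) (k : ℕ) (Q : ℕ → A) :
    Prop :=
  if k ≤ N then Q k = coord q k else Q k ∈ V ∧ coeff k (schw D (mk Q)) = 0

lemma NonlocalAt.congr {D : Derivation ℚ A A} {V : Set A} {N : ℕ} {q : Fin N → A} (k : ℕ)
    (f g : ℕ → A) (h : ∀ i ≤ k, f i = g i) (hf : NonlocalAt D V q k f) :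
    NonlocalAt D V q k g := by
  unfold NonlocalAt at hf ⊢
  rwa [← coeff_schw_congr D h, ← h k le_rfl]

lemma NonlocalAt.mem {D : Derivation ℚ A A} {V : Set A} {N : ℕ} {q : Fin N → A}
    (hq : ∀ j, q j ∈ V) {k : ℕ} (hk : 1 ≤ k) {f : ℕ → A} (hf : NonlocalAt D V q k f) :
    f k ∈ V := by
  unfold NonlocalAt at hf
  split_ifs at hf with h
  · rw [hf, coord_of_pos q hk h]
    exact hq _
  · exact hf.1

lemma NonlocalAt.zero {D : Derivation ℚ A A} {V : Set A} {N : ℕ} {q : Fin N → A}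
    {f : ℕ → A} (hf : NonlocalAt D V q 0 f) : f 0 = 1 := by
  unfold NonlocalAt at hf
  rwa [if_pos (Nat.zero_le N), coord_zero] at hf

/-- The rest r is computed from the sequence cut off at k, because only the entries of index between
1 and k - 1 are known to lie in V. -/
lemma coeff_schw_update (D : Derivation ℚ A A) {V : NonUnitalSubalgebra ℚ A}
    (hD : ∀ a ∈ V, D a ∈ V) {N : ℕ} {q : Fin N → A} (hq : ∀ j, q j ∈ V) {k : ℕ} (hk : N < k)
    {f : ℕ → A} (hf : ∀ j < k, NonlocalAt D (V : Set A) q j f) :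
    ∃ r ∈ V, ∀ c, coeff k (schw D (mk (Function.update f k c))) = r - 2 * D (D c) := by
  have h0 : f 0 = 1 := (hf 0 (by omega)).zero
  refine ⟨coeff k (schw D (mk fun i => if i < k then f i else 0)),
    coeff_schw_mem D hD (by rw [if_pos (by omega), h0]) (fun i hi => ?_) k, fun c => ?_⟩
  · split_ifs with h
    · exact (hf i h).mem hq hi
    · exact V.zero_mem
  · rw [mk_update, coeff_schw_add_monomial D _ c (by omega)]
    · congr 1
      refine coeff_schw_congr D fun i hi => ?_
      rw [Function.update_apply]
      split_ifs <;> first | rfl | omega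
    · rw [PowerSeries.coeff_mk, Function.update_of_ne (by omega), h0]

lemma exists_nonlocal_seq {D : Derivation ℚ A A} {V : NonUnitalSubalgebra ℚ A}
    (hV : Set.BijOn D (V : Set A) (V : Set A)) {N : ℕ} {q : Fin N → A} (hq : ∀ j, q j ∈ V) :
    ∃ f, ∀ k, NonlocalAt D (V : Set A) q k f := by
  have : Inhabited A := ⟨0⟩
  refine exists_seq_of_triangular _ NonlocalAt.congr fun k f hf => ?_
  rcases Nat.lt_or_ge N k with hk | hk
  · obtain ⟨r, hr, h⟩ := coeff_schw_update D hV.mapsTo hq hk hf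
    -- The equation for the new entry c is 2 c_xx = r, solved by integrating r / 2 twice within V.
    obtain ⟨b, hb, hb'⟩ := hV.surjOn (V.smul_mem (1 / 2 : ℚ) hr)
    obtain ⟨c, hc, hc'⟩ := hV.surjOn hb
    refine ⟨c, ?_⟩
    rw [NonlocalAt, if_neg (by omega), Function.update_self, h, hc', hb', two_mul_half_smul,
      sub_self]
    exact ⟨hc, rfl⟩
  · refine ⟨coord q k, ?_⟩
    rw [NonlocalAt, if_pos hk, Function.update_self]

lemma nonlocal_seq_unique {D : Derivation ℚ A A} {V : NonUnitalSubalgebra ℚ A}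
    (hV : Set.BijOn D (V : Set A) (V : Set A)) {N : ℕ} {q : Fin N → A} (hq : ∀ j, q j ∈ V) {K : ℕ}
    {f g : ℕ → A} (hf : ∀ k < K, NonlocalAt D (V : Set A) q k f)
    (hg : ∀ k < K, NonlocalAt D (V : Set A) q k g) : ∀ k < K, f k = g k := by
  refine seq_unique_of_triangular _ NonlocalAt.congr (fun k f hf c c' hc hc' => ?_) hf hg
  rcases Nat.lt_or_ge N k with hk | hk
  · obtain ⟨r, hr, h⟩ := coeff_schw_update D hV.mapsTo hq hk hf
    rw [NonlocalAt, if_neg (by omega), Function.update_self, h] at hc hc'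
    refine hV.injOn hc.1 hc'.1 (hV.injOn (hV.mapsTo hc.1) (hV.mapsTo hc'.1) ?_)
    rw [← sub_eq_zero]
    apply eq_zero_of_two_mul_eq_zero
    linear_combination hc'.2 - hc.2
  · rw [NonlocalAt, if_pos hk, Function.update_self] at hc hc'
    rw [hc, hc']

lemma isNonlocalElim_iff (D : Derivation ℚ A A) {V : Set A} {N n : ℕ} (hn : N ≤ n) {q : Fin N → A}
    (hq : ∀ j, q j ∈ V) (Q : Fin n → A) :
    IsNonlocalElim D V q Q ↔ ∀ k < n + 1, NonlocalAt D V q k (coord Q) := by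
  constructor
  · rintro ⟨h1, h2, h3⟩ k hk
    rw [NonlocalAt]
    split_ifs with h
    · rcases Nat.eq_zero_or_pos k with rfl | hk
      · rfl
      · have := h1 ⟨k - 1, by omega⟩
        rwa [← coord_of_pos q hk h, Nat.sub_add_cancel hk] at this
    · refine ⟨?_, ?_⟩
      · rw [coord_of_pos Q (by omega) (by omega)]
        exact h2 _
      -- The coefficient of X^k comes from the zero-based index i = n + N - k, so the equations with
      -- N ≤ i < n are those with N < k ≤ n in reverse order.
      · have := h3 ⟨n + N - k, by omega⟩ (by simp only; omega)
        rw [eulerLagrange_nonlocal, quarter_smul_eq_zero] at this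
        rwa [show n + N - (n + N - k) = k by omega] at this
  · intro h
    refine ⟨fun j => ?_, fun i => ?_, fun i hi => ?_⟩
    · have := h (j + 1) (by omega)
      rwa [NonlocalAt, if_pos (by omega), coord_succ q] at this
    · rw [← coord_succ Q i]
      exact (h (i + 1) (by omega)).mem hq (by omega)
    · have := h (n + N - i) (by omega)
      rw [NonlocalAt, if_neg (by omega)] at this
      rw [eulerLagrange_nonlocal, this.2, smul_zero]

lemma coord_trunc {f : ℕ → A} (h0 : f 0 = 1) (n : ℕ) {k : ℕ} (hk : k ≤ n) :
    coord (fun i : Fin n => f (i + 1)) k = f k := by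
  rcases Nat.eq_zero_or_pos k with rfl | h
  · rw [coord_zero, h0]
  · rw [coord_of_pos _ h hk]
    simp only
    rw [Nat.sub_add_cancel h]

lemma isNonlocalElim_trunc {D : Derivation ℚ A A} {V : Set A} {N n : ℕ} (hn : N ≤ n)
    {q : Fin N → A} (hq : ∀ j, q j ∈ V) {f : ℕ → A} (hf : ∀ k, NonlocalAt D V q k f) :
    IsNonlocalElim D V q fun i : Fin n => f (i + 1) := by
  rw [isNonlocalElim_iff D hn hq]
  intro k hk
  exact (hf k).congr k _ _ fun i hi => (coord_trunc (hf 0).zero n (by omega)).symm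

lemma isNonlocalElim_unique {D : Derivation ℚ A A} {V : NonUnitalSubalgebra ℚ A}
    (hV : Set.BijOn D (V : Set A) (V : Set A)) {N n : ℕ} (hn : N ≤ n) {q : Fin N → A}
    (hq : ∀ j, q j ∈ V) {Q Q' : Fin n → A} (h : IsNonlocalElim D (V : Set A) q Q)
    (h' : IsNonlocalElim D (V : Set A) q Q') : Q = Q' := by
  rw [isNonlocalElim_iff D hn hq] at h h'
  ext i
  rw [← coord_succ Q, ← coord_succ Q']
  exact nonlocal_seq_unique hV hq h h' _ (by omega)

lemma nonlocalElim_eq {D : Derivation ℚ A A} {V : NonUnitalSubalgebra ℚ A}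
    (hV : Set.BijOn D (V : Set A) (V : Set A)) {N n : ℕ} (hn : N ≤ n) {q : Fin N → A}
    (hq : ∀ j, q j ∈ V) {f : ℕ → A} (hf : ∀ k, NonlocalAt D (V : Set A) q k f) :
    nonlocalElim D (V : Set A) n q = fun i : Fin n => f (i + 1) := by
  have h : ∃ Q : Fin n → A, IsNonlocalElim D (V : Set A) q Q := ⟨_, isNonlocalElim_trunc hn hq hf⟩
  rw [nonlocalElim, dif_pos h]
  exact isNonlocalElim_unique hV hn hq h.choose_spec (isNonlocalElim_trunc hn hq hf)

lemma nonlocalField_eq {D : Derivation ℚ A A} {V : NonUnitalSubalgebra ℚ A}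
    (hV : Set.BijOn D (V : Set A) (V : Set A)) {N : ℕ} {q : Fin N → A}
    (hq : ∀ j, q j ∈ V) {f : ℕ → A} (hf : ∀ k, NonlocalAt D (V : Set A) q k f) {s r : ℕ}
    (hr : 1 ≤ r) (hs : r ≤ s) (j : Fin N) :
    nonlocalField N s r A D V q j = killing D r f (j + 1) := by
  rw [nonlocalField, nonlocalElim_eq hV (by omega) hq hf]
  exact killing_congr D r (by omega) hr fun k _ hk _ =>
    coord_trunc (hf 0).zero _ (by omega)

/-! ### Tangency -/

/-- Z_{r+1} multiplies out to X^r S_t = a S_x + 2 a_x S + 2 a_xxx with a of degree ≤ r. If S has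
degree ≤ N, the right side has degree ≤ r + N, hence S_t has degree ≤ N. -/
lemma coeff_schw_flow (D : Derivation ℚ A A) {N r : ℕ} (hr : 1 ≤ r) {Q : ℕ → A} (h0 : Q 0 = 1)
    (hQ : ∀ k, N < k → coeff k (schw D (mk Q)) = 0) {k : ℕ} (hk : N < k) :
    coeff k (schw (dualD D) (mk (flow D r Q))) = 0 := by
  obtain ⟨r, rfl⟩ : ∃ m, r = m + 1 := ⟨r - 1, by omega⟩
  have hu : IsUnit (mk Q) := isUnit_mk (by rw [h0]; exact isUnit_one)
  rw [mk_flow D _ h0, schw_ptS D hu, coeff_ptS, hQ k hk, ← pt_zero_zero]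
  congr 1
  rw [← PowerSeries.coeff_X_pow_mul _ r, schw_flow D hu (X_pow_mul_killS D r (mk Q))]
  have ha := degLE_lowS r (mk Q)
  have hs : DegLE (schw D (mk Q)) N := hQ
  have h : DegLE (lowS (r + 1) (mk Q) * coeffD D (schw D (mk Q))
      + 2 * coeffD D (lowS (r + 1) (mk Q)) * schw D (mk Q)
      + 2 * coeffD D (coeffD D (coeffD D (lowS (r + 1) (mk Q))))) (0 + r + N) := by
    refine DegLE.add (DegLE.add ?_ ?_) ?_
    · exact (ha.mul (hs.coeffD D)).mono (by omega)
    · exact ((degLE_two 0).mul (ha.coeffD D)).mul hs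
    · exact ((degLE_two 0).mul (((ha.coeffD D).coeffD D).coeffD D)).mono (by omega)
  exact h _ (by omega)

lemma solvesElim_iff (D : Derivation ℚ A A) {N : ℕ} {Q : ℕ → A} (h0 : Q 0 = 1) :
    SolvesElim D N Q ↔ ∀ k, N < k → coeff k (schw D (mk Q)) = 0 := by
  constructor
  · intro h k hk
    -- The coefficient of X^k is already obtained with n = k and the zero-based index N.
    have := h k ⟨N, hk⟩ le_rfl
    rw [eulerLagrange_nonlocal, quarter_smul_eq_zero] at this
    rw [← this]
    simp only
    rw [Nat.add_sub_cancel]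
    exact coeff_schw_congr D fun i hi => (coord_trunc h0 k hi).symm
  · intro h n i hi
    rw [eulerLagrange_nonlocal, quarter_smul_eq_zero, ← h (n + N - i) (by omega)]
    exact coeff_schw_congr D fun j hj => coord_trunc h0 n (by omega)

lemma solvesElim_congr (D : Derivation ℚ A A) {N : ℕ} {Q Q' : ℕ → A}
    (h : ∀ k, 1 ≤ k → Q k = Q' k) : SolvesElim D N Q ↔ SolvesElim D N Q' := by
  have e : ∀ n : ℕ, (fun j : Fin n => Q (j + 1)) = fun j : Fin n => Q' (j + 1) := fun n =>
    funext fun j => h _ (by omega)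
  simp only [SolvesElim, e]

/-- A sequence with the convention that its entry with index `0` is `1`. -/
def normalize (Q : ℕ → A) (k : ℕ) : A := if k = 0 then 1 else Q k

lemma normalize_of_pos (Q : ℕ → A) {k : ℕ} (hk : 1 ≤ k) : normalize Q k = Q k :=
  if_neg (by omega)

lemma killing_normalize (D : Derivation ℚ A A) {r : ℕ} (hr : 1 ≤ r) (Q : ℕ → A) {l : ℕ}
    (hl : 1 ≤ l) : killing D r (normalize Q) l = killing D r Q l :=
  killing_congr D r hl hr fun _ hk _ _ => normalize_of_pos Q hk

lemma flow_normalize (D : Derivation ℚ A A) {r : ℕ} (hr : 1 ≤ r) (Q : ℕ → A) {k : ℕ}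
    (hk : 1 ≤ k) : flow D r (normalize Q) k = pt (Q k) (killing D r Q k) := by
  rw [flow, if_neg (by omega), normalize_of_pos Q hk, killing_normalize D hr Q hk]

lemma solvesElim_flow (D : Derivation ℚ A A) {N : ℕ} {Q : ℕ → A} (h : SolvesElim D N Q) {r : ℕ}
    (hr : 1 ≤ r) : SolvesElim (dualD D) N fun j => pt (Q j) (killing D r Q j) := by
  rw [← solvesElim_congr (dualD D) fun k hk => flow_normalize D hr Q hk,
    solvesElim_iff _ (flow_zero D r rfl)]
  rw [← solvesElim_congr D fun k hk => normalize_of_pos Q hk, solvesElim_iff D rfl] at h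
  exact fun k hk => coeff_schw_flow D hr rfl h hk

lemma killing_comm (D : Derivation ℚ A A) {i j : ℕ} (hi : 1 ≤ i) (hj : 1 ≤ j) (Q : ℕ → A) {l : ℕ}
    (hl : 1 ≤ l) : (killing (dualD D) j (fun k => pt (Q k) (killing D i Q k)) l).snd
      = (killing (dualD D) i (fun k => pt (Q k) (killing D j Q k)) l).snd := by
  rw [← killing_congr (dualD D) j hl hj fun k hk _ _ => flow_normalize D hi Q hk,
    ← killing_congr (dualD D) i hl hi fun k hk _ _ => flow_normalize D hj Q hk]
  exact killing_flow_comm D hi hj rfl hl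

/-- `V + ε V`. -/
def dualV (V : NonUnitalSubalgebra ℚ A) : NonUnitalSubalgebra ℚ (DualNumber A) where
  carrier := nonlocalLift A V
  add_mem' ha hb := ⟨V.add_mem ha.1 hb.1, V.add_mem ha.2 hb.2⟩
  zero_mem' := ⟨V.zero_mem, V.zero_mem⟩
  mul_mem' ha hb := by
    refine ⟨V.mul_mem ha.1 hb.1, ?_⟩
    simp only [snd_mul, smul_eq_mul, MulOpposite.smul_eq_mul_unop, MulOpposite.unop_op]
    exact V.add_mem (V.mul_mem ha.1 hb.2) (V.mul_mem ha.2 hb.1)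
  smul_mem' c x hx := ⟨V.smul_mem c hx.1, V.smul_mem c hx.2⟩

lemma bijOn_dualD {D : Derivation ℚ A A} {V : NonUnitalSubalgebra ℚ A}
    (hV : Set.BijOn D (V : Set A) (V : Set A)) :
    Set.BijOn (dualD D) (dualV V : Set (DualNumber A)) (dualV V : Set (DualNumber A)) := by
  have e : ∀ z, dualD D z = pt (D z.fst) (D z.snd) := fun _ => rfl
  refine ⟨fun z hz => ?_, fun z hz w hw h => ?_, fun z hz => ?_⟩
  · rw [e]
    exact ⟨by simpa using hV.mapsTo hz.1, by simpa using hV.mapsTo hz.2⟩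
  · rw [e, e] at h
    ext
    · exact hV.injOn hz.1 hw.1 (by simpa using congrArg fst h)
    · exact hV.injOn hz.2 hw.2 (by simpa using congrArg snd h)
  · obtain ⟨a, ha, ha'⟩ := hV.surjOn hz.1
    obtain ⟨b, hb, hb'⟩ := hV.surjOn hz.2
    exact ⟨pt a b, ⟨by simpa using ha, by simpa using hb⟩, by rw [dualD_pt, ha', hb', pt_fst_snd]⟩

lemma killing_mem {D : Derivation ℚ A A} {V : NonUnitalSubalgebra ℚ A} (hD : ∀ a ∈ V, D a ∈ V)
    {Q : ℕ → A} (hQ : ∀ k, 1 ≤ k → Q k ∈ V) {r l : ℕ} (hr : 1 ≤ r) (hl : 1 ≤ l) :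
    killing D r Q l ∈ V := by
  rw [killing]
  refine V.add_mem (hD _ (hQ _ (by omega))) (V.sum_mem fun k hk => ?_)
  rw [Finset.mem_Icc] at hk
  have h1 := hQ k (by omega)
  have h2 := hQ (l + r - k - 1) (by omega)
  exact V.sub_mem (V.mul_mem h1 (hD _ h2)) (V.mul_mem h2 (hD _ h1))

/-- The Killing flows are tangent to the solutions of the nonlocal elimination equations. -/
lemma nonlocalAt_flow {D : Derivation ℚ A A} {V : NonUnitalSubalgebra ℚ A}
    (hV : Set.BijOn D (V : Set A) (V : Set A)) {N : ℕ} {q : Fin N → A} (hq : ∀ j, q j ∈ V)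
    {f : ℕ → A} (hf : ∀ k, NonlocalAt D (V : Set A) q k f) {r : ℕ} (hr : 1 ≤ r) (k : ℕ) :
    NonlocalAt (dualD D) (dualV V : Set (DualNumber A))
      (fun j => pt (q j) (killing D r f (j + 1))) k (flow D r f) := by
  have h0 := (hf 0).zero
  have hfq := hf k
  rw [NonlocalAt] at hfq ⊢
  split_ifs at hfq ⊢ with hk
  · rcases Nat.eq_zero_or_pos k with rfl | hk'
    · rw [flow_zero D r h0, coord_zero]
    · rw [coord_of_pos _ hk' hk, flow, if_neg (by omega), hfq, coord_of_pos _ hk' hk]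
      simp only
      rw [Nat.sub_add_cancel hk']
  · refine ⟨?_, coeff_schw_flow D hr h0 (fun m hm => ?_) (not_le.1 hk)⟩
    · rw [flow, if_neg (by omega)]
      exact ⟨by simpa using hfq.1, by
        simpa using killing_mem hV.mapsTo (fun k hk => (hf k).mem hq hk) hr (by omega)⟩
    · have := hf m
      rw [NonlocalAt, if_neg (by omega)] at this
      exact this.2

/-- The flow of the eliminated sequence solves the elimination equations over A[ε], so by uniqueness
it is the elimination at the perturbed point. This reduces brackets of the reduced fields to those
of the Killing fields. -/
lemma nonlocalField_dual {D : Derivation ℚ A A} {V : NonUnitalSubalgebra ℚ A}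
    (hV : Set.BijOn D (V : Set A) (V : Set A)) {N : ℕ} {q : Fin N → A} (hq : ∀ j, q j ∈ V)
    {f : ℕ → A} (hf : ∀ k, NonlocalAt D (V : Set A) q k f) {i j : ℕ} (hi : 1 ≤ i) (hj : 1 ≤ j)
    (l : Fin N) :
    Zbar N j (DualNumber A) (dualD D) (nonlocalLift A V)
        (fun m => pt (q m) (killing D i f (m + 1))) l
      = killing (dualD D) j (flow D i f) (l + 1) := by
  refine nonlocalField_eq (bijOn_dualD hV) (fun m => ?_) (nonlocalAt_flow hV hq hf hi) hj le_rfl l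
  exact ⟨by simpa using hq m, by
    simpa using killing_mem hV.mapsTo (fun k hk => (hf k).mem hq hk) hi (by omega)⟩

theorem nonlocal_hierarchy {N : ℕ} (D : Derivation ℚ A A) (V : NonUnitalSubalgebra ℚ A)
    (hV : Set.BijOn D (V : Set A) (V : Set A)) (q : Fin N → A) (hq : ∀ j, q j ∈ V) :
    (∀ s : ℕ, 2 ≤ s →
      (∃! Q : Fin (s + N - 1) → A, IsNonlocalElim D (V : Set A) q Q) ∧
      ∀ r : ℕ, 2 ≤ r → r ≤ s → nonlocalField N s r A D V q = Zbar N r A D V q) ∧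
    (∀ r : ℕ, 2 ≤ r → ∀ j, Zbar N r A D V q j ∈ V) ∧
    (∀ i j : ℕ, 2 ≤ i → 2 ≤ j →
      bracket nonlocalLift (Zbar.{u} N i) (Zbar.{u} N j) A D V q = 0) ∧
    (∀ i : ℕ, 2 ≤ i →
      bracket nonlocalLift (Zbar.{u} N i) (translation.{u} N) A D V q = 0) := by
  obtain ⟨f, hf⟩ := exists_nonlocal_seq hV hq
  have hZ : ∀ r, 1 ≤ r → Zbar N r A D V q = fun j : Fin N => killing D r f (j + 1) := fun r hr =>
    funext fun j => nonlocalField_eq hV hq hf hr le_rfl j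
  have h0 := (hf 0).zero
  refine ⟨fun s hs => ⟨⟨_, isNonlocalElim_trunc (by omega) hq hf, fun Q hQ =>
    isNonlocalElim_unique hV (by omega) hq hQ (isNonlocalElim_trunc (by omega) hq hf)⟩,
    fun r hr hrs => ?_⟩, fun r hr j => ?_, fun i j hi hj => ?_, fun i hi => ?_⟩
  · rw [hZ r (by omega)]
    exact funext fun j => nonlocalField_eq hV hq hf (by omega) hrs j
  · rw [hZ r (by omega)]
    exact killing_mem hV.mapsTo (fun k hk => (hf k).mem hq hk) (by omega) (by omega)
  · ext l
    rw [bracket, hZ i (by omega), hZ j (by omega), nonlocalField_dual hV hq hf (by omega) (by omega),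
      nonlocalField_dual hV hq hf (by omega) (by omega),
      killing_flow_comm D (by omega) (by omega) h0 (by omega), sub_self, Pi.zero_apply]
  · ext l
    have ht : translation N A D V q = fun j : Fin N => killing D 1 f (j + 1) := funext fun j => by
      rw [killing_one D f (by omega), translation]
      have := hf (j + 1)
      rw [NonlocalAt, if_pos (by omega), coord_succ q] at this
      rw [this]
    rw [bracket, ht, nonlocalField_dual hV hq hf le_rfl (by omega),
      killing_flow_comm D le_rfl (by omega) h0 (by omega), killing_one _ _ (by omega), hZ i (by omega),
      translation, flow, if_neg (by omega), dualD_pt, dualD_pt, snd_pt, snd_pt, sub_self,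
      Pi.zero_apply]

end Nonlocal

/-! ### Reversal of series of bounded degree -/

section Reflect

variable {A : Type u} [CommRing A] [Algebra ℚ A]

/-- The terms of degree at most `d` of `f`, in reversed order: `X ^ d * f (1 / X)`. -/
noncomputable def reflS (d : ℕ) (f : A⟦X⟧) : A⟦X⟧ :=
  mk fun k => if k ≤ d then coeff (d - k) f else 0

@[simp] lemma coeff_reflS (d k : ℕ) (f : A⟦X⟧) :
    coeff k (reflS d f) = if k ≤ d then coeff (d - k) f else 0 := PowerSeries.coeff_mk _ _

lemma reflS_add (d : ℕ) (f g : A⟦X⟧) : reflS d (f + g) = reflS d f + reflS d g := by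
  ext k
  simp only [map_add, coeff_reflS]
  split_ifs <;> simp

lemma reflS_sub (d : ℕ) (f g : A⟦X⟧) : reflS d (f - g) = reflS d f - reflS d g := by
  ext k
  simp only [map_sub, coeff_reflS]
  split_ifs <;> simp

lemma reflS_coeffD (D : Derivation ℚ A A) (d : ℕ) (f : A⟦X⟧) :
    reflS d (coeffD D f) = coeffD D (reflS d f) := by
  ext k
  simp only [coeff_coeffD, coeff_reflS]
  split_ifs <;> simp

lemma reflS_X_pow (d : ℕ) : reflS d (X ^ d : A⟦X⟧) = 1 := by
  ext k
  rw [coeff_reflS, PowerSeries.coeff_X_pow, PowerSeries.coeff_one]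
  split_ifs <;> first | rfl | omega

lemma reflS_one (d : ℕ) : reflS d (1 : A⟦X⟧) = X ^ d := by
  ext k
  rw [coeff_reflS, PowerSeries.coeff_X_pow, PowerSeries.coeff_one]
  split_ifs <;> first | rfl | omega

lemma degLE_one (d : ℕ) : DegLE (1 : A⟦X⟧) d := fun k hk => by
  rw [PowerSeries.coeff_one, if_neg (by omega)]

lemma coe_trunc {d : ℕ} {f : A⟦X⟧} (hf : DegLE f d) :
    ((PowerSeries.trunc (d + 1) f : Polynomial A) : A⟦X⟧) = f := by
  ext k
  rw [Polynomial.coeff_coe, PowerSeries.coeff_trunc]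
  split_ifs with h
  · rfl
  · rw [hf k (by omega)]

lemma reflS_coe {d : ℕ} {p : Polynomial A} (hp : p.natDegree ≤ d) :
    reflS d (p : A⟦X⟧) = (p.reflect d : Polynomial A) := by
  ext k
  rw [coeff_reflS, Polynomial.coeff_coe, Polynomial.coeff_coe, Polynomial.coeff_reflect]
  split_ifs with h
  · rw [Polynomial.revAt_le h]
  · rw [Polynomial.revAt_eq_self_of_lt (by omega),
      Polynomial.coeff_eq_zero_of_natDegree_lt (by omega)]

lemma reflS_mul {d e : ℕ} {f g : A⟦X⟧} (hf : DegLE f d) (hg : DegLE g e) :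
    reflS (d + e) (f * g) = reflS d f * reflS e g := by
  have h1 : (PowerSeries.trunc (d + 1) f).natDegree ≤ d :=
    Nat.lt_succ_iff.1 (PowerSeries.natDegree_trunc_lt f d)
  have h2 : (PowerSeries.trunc (e + 1) g).natDegree ≤ e :=
    Nat.lt_succ_iff.1 (PowerSeries.natDegree_trunc_lt g e)
  rw [← coe_trunc hf, ← coe_trunc hg, ← Polynomial.coe_mul, reflS_coe h1, reflS_coe h2,
    reflS_coe (Polynomial.natDegree_mul_le_of_le h1 h2), Polynomial.reflect_mul _ _ h1 h2,
    Polynomial.coe_mul]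

lemma reflS_wron (D : Derivation ℚ A A) {d e : ℕ} {f g : A⟦X⟧} (hf : DegLE f d)
    (hg : DegLE g e) : reflS (d + e) (wron D f g) = wron D (reflS d f) (reflS e g) := by
  rw [wron, reflS_sub, reflS_mul hf (hg.coeffD D), reflS_mul (hf.coeffD D) hg, reflS_coeffD,
    reflS_coeffD, wron]

lemma DegLE.of_X_pow_mul {f : A⟦X⟧} {d e : ℕ} (h : DegLE (X ^ e * f) (e + d)) : DegLE f d :=
  fun k hk => by
    rw [← PowerSeries.coeff_X_pow_mul f e k]
    exact h _ (by omega)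

/-- The convention q_k = 0 for k > n is respected by the Killing flows, so they act on n
coordinates. -/
lemma degLE_killS (D : Derivation ℚ A A) {r n : ℕ} (hr : 1 ≤ r) {f : A⟦X⟧} (hf : DegLE f n) :
    DegLE (killS D r f) n := by
  obtain ⟨r, rfl⟩ : ∃ m, r = m + 1 := ⟨r - 1, by omega⟩
  apply DegLE.of_X_pow_mul (e := r)
  rw [X_pow_mul_killS]
  have h := degLE_lowS r f
  exact (h.mul (hf.coeffD D)).sub ((h.coeffD D).mul hf)

/-- The third order operator attached to `u`. -/
noncomputable def thirdOrder (D : Derivation ℚ A A) (N : ℕ) (u f : A⟦X⟧) : A⟦X⟧ :=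
  f * coeffD D u + 2 * coeffD D f * u + 2 * (X ^ N * coeffD D (coeffD D (coeffD D f)))

lemma thirdOrder_add (D : Derivation ℚ A A) (N : ℕ) (u f g : A⟦X⟧) :
    thirdOrder D N u (f + g) = thirdOrder D N u f + thirdOrder D N u g := by
  simp only [thirdOrder, map_add]
  ring

lemma thirdOrder_X_pow_mul (D : Derivation ℚ A A) (N : ℕ) (u f : A⟦X⟧) (p : ℕ) :
    thirdOrder D N u (X ^ p * f) = X ^ p * thirdOrder D N u f := by
  simp only [thirdOrder, coeffD_X_pow_mul]
  ring

/-- The Killing flow in terms of the reversed series. -/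
lemma reflS_killS (D : Derivation ℚ A A) {n p : ℕ} (hp : p ≤ n) {f : A⟦X⟧} (hf : DegLE f n) :
    reflS n (killS D (n - p + 1) f) = wron D (shiftS p (reflS n f)) (reflS n f) := by
  have h1 : reflS (n - p) (lowS (n - p + 1) f) = shiftS p (reflS n f) := by
    ext k
    rw [coeff_reflS, coeff_shiftS, coeff_reflS, coeff_lowS, if_pos (show n - p - k < n - p + 1 by omega)]
    refine if_ctx_congr (by omega) (fun _ => ?_) fun _ => rfl
    rw [Nat.sub_sub]
  have h2 := reflS_mul (degLE_X_pow (A := A) (n - p)) (degLE_killS D (r := n - p + 1) (by omega) hf)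
  rw [reflS_X_pow, one_mul, X_pow_mul_killS, reflS_wron D (degLE_lowS _ f) hf, h1] at h2
  exact h2.symm

lemma coeff_mul_low (f g : A⟦X⟧) (N : ℕ) {k : ℕ} (hk : k ≤ N) :
    coeff k (f * lowS (N + 1) g) = coeff k (f * g) := by
  rw [PowerSeries.coeff_mul, PowerSeries.coeff_mul]
  refine Finset.sum_congr rfl fun p hp => ?_
  have hp := Finset.HasAntidiagonal.mem_antidiagonal.1 hp
  rw [coeff_lowS, if_pos (by omega)]

/-- The variation of the non-negative part of `λ ^ N U` along a Killing flow. -/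
lemma coeff_variation_polyPart (D : Derivation ℚ A A) {n p N : ℕ} (hp : 1 ≤ p) (hpn : p ≤ n)
    {f S : A⟦X⟧} (hf : DegLE f n) (k : ℕ) :
    coeff k (reflS N (-(X * shiftS (n - p + 1) f) * coeffD D S
      + 2 * coeffD D (-(X * shiftS (n - p + 1) f)) * S
      + 2 * coeffD D (coeffD D (coeffD D (-(X * shiftS (n - p + 1) f))))))
    = -coeff (k + p) (thirdOrder D N (reflS N S) (lowS p (reflS n f))) := by
  set B := X * shiftS (n - p + 1) f with hB
  -- B is made of the last p coefficients of f, so it has degree at most p and its reversal consists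
  -- of the first p terms of P.
  have hBp : DegLE B p := fun m hm => by
    obtain ⟨m, rfl⟩ : ∃ i, m = i + 1 := ⟨m - 1, by omega⟩
    rw [hB, PowerSeries.coeff_succ_X_mul, coeff_shiftS, hf _ (by omega)]
  have hBr : reflS p B = lowS p (reflS n f) := by
    ext m
    rw [coeff_reflS, coeff_lowS, coeff_reflS]
    rcases lt_trichotomy m p with h | rfl | h
    · rw [if_pos h.le, if_pos h, if_pos (by omega), show p - m = p - m - 1 + 1 by omega, hB,
        PowerSeries.coeff_succ_X_mul, coeff_shiftS]
      congr 2
      omega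
    · rw [if_pos le_rfl, if_neg (by omega), Nat.sub_self, hB, PowerSeries.coeff_zero_X_mul]
    · rw [if_neg (by omega), if_neg (by omega)]
  -- Reversal is multiplicative only on bounded degrees. Cutting S at degree N changes no
  -- coefficient of degree ≤ N, and no others are compared.
  set S' := lowS (N + 1) S with hS'
  have hSr : reflS N S' = reflS N S := by
    ext m
    rw [coeff_reflS, coeff_reflS, hS', coeff_lowS, if_pos (show N - m < N + 1 by omega)]
  have hSN : DegLE S' N := degLE_lowS N S
  have hDS : coeffD D S' = lowS (N + 1) (coeffD D S) := by
    ext m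
    rw [coeff_coeffD, hS', coeff_lowS, coeff_lowS]
    split_ifs <;> simp
  -- The factor 1, viewed as having degree ≤ N, is what reverses to X^N in `thirdOrder`.
  set R := B * coeffD D S' + 2 * (coeffD D B * S')
      + 2 * (coeffD D (coeffD D (coeffD D B)) * 1) with hR
  have two_refl : ∀ d (g : A⟦X⟧), reflS d (2 * g) = 2 * reflS d g := fun d g => by
    rw [two_mul, reflS_add, two_mul]
  have hRr : reflS (p + N) R = thirdOrder D N (reflS N S) (lowS p (reflS n f)) := by
    have hB3 := ((hBp.coeffD D).coeffD D).coeffD D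
    rw [hR, reflS_add, reflS_add, two_refl, two_refl, reflS_mul hBp (hSN.coeffD D),
      reflS_mul (hBp.coeffD D) hSN, reflS_mul hB3 (degLE_one N), reflS_one]
    simp only [reflS_coeffD, hBr, hSr, thirdOrder]
    ring
  rw [← hRr, coeff_reflS, coeff_reflS]
  by_cases hk : k ≤ N
  · rw [if_pos hk, if_pos (by omega), show p + N - (k + p) = N - k by omega, hR]
    have e : -B * coeffD D S + 2 * coeffD D (-B) * S + 2 * coeffD D (coeffD D (coeffD D (-B)))
        = -(B * coeffD D S + 2 * (coeffD D B * S)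
          + 2 * (coeffD D (coeffD D (coeffD D B)) * 1)) := by
      simp only [map_neg]
      ring
    rw [e, map_neg]
    simp only [two_mul, map_add]
    rw [hDS, coeff_mul_low _ _ N (by omega), hS', coeff_mul_low _ _ N (by omega)]
  · rw [if_neg hk, if_neg (by omega), neg_zero]

/-- The defect in the elimination equations of the local hierarchy. -/
noncomputable def defect (D : Derivation ℚ A A) (N : ℕ) (u P : A⟦X⟧) : A⟦X⟧ :=
  u - X ^ N * schw D P + Ring.inverse P ^ 2

lemma defect_ptS (D : Derivation ℚ A A) (N : ℕ) (u v : A⟦X⟧) {P : A⟦X⟧} (hP : IsUnit P)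
    (g : A⟦X⟧) : defect (dualD D) N (ptS u v) (ptS P g) = ptS (defect D N u P)
      (v - X ^ N * (-(2 * coeffD D (coeffD D (g * Ring.inverse P)))
        - 2 * logD D P * coeffD D (g * Ring.inverse P)) - 2 * g * Ring.inverse P ^ 3) := by
  rw [defect, schw_ptS D hP, inverse_ptS hP, ← ptS_X_pow, pow_two, ptS_mul, ptS_mul, ptS_sub,
    ptS_add, defect]
  congr 1 <;> ring

/-- With u = X^N S[P] - P⁻² + defect, the first part cancels the third derivative by
`third_order_apply_self`, and P⁻² is annihilated by h ↦ P h_x + 2 P_x h. -/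
lemma thirdOrder_self (D : Derivation ℚ A A) (N : ℕ) (u : A⟦X⟧) {P : A⟦X⟧} (hP : IsUnit P) :
    thirdOrder D N u P
      = coeffD D (defect D N u P) * P + 2 * defect D N u P * coeffD D P := by
  have h := third_order_apply_self D hP
  have hG := coeffD_inverse D hP
  have hPG := Ring.mul_inverse_cancel P hP
  simp only [thirdOrder, defect, map_add, map_sub, coeffD_X_pow_mul, pow_two (Ring.inverse P),
    coeffD_mul D (Ring.inverse P), hG]
  linear_combination X ^ N * h + 2 * Ring.inverse P ^ 2 * coeffD D P * hPG

/-- The local elimination equations of order `< s` are preserved up to order `s - p`. -/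
lemma X_pow_dvd_defect_variation (D : Derivation ℚ A A) (N : ℕ) {u v P g : A⟦X⟧} (hP : IsUnit P)
    {p s : ℕ} (hu : X ^ s ∣ defect D N u P) (hg : g = wron D (shiftS p P) P)
    (hv : ∀ k, coeff k v = -coeff (k + p) (thirdOrder D N u (lowS p P))) :
    X ^ (s - p) ∣ v - X ^ N * (-(2 * coeffD D (coeffD D (g * Ring.inverse P)))
        - 2 * logD D P * coeffD D (g * Ring.inverse P)) - 2 * g * Ring.inverse P ^ 3 := by
  have hs := schw_flow D hP (e := 0) (a := shiftS p P) (g := g) (by rw [pow_zero, one_mul, hg])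
  rw [pow_zero, one_mul] at hs
  set a := shiftS p P with ha
  set Θ := defect D N u P with hΘ
  have e : v - X ^ N * (-(2 * coeffD D (coeffD D (g * Ring.inverse P)))
        - 2 * logD D P * coeffD D (g * Ring.inverse P)) - 2 * g * Ring.inverse P ^ 3
      = (v - thirdOrder D N u a) + (a * coeffD D Θ + 2 * coeffD D a * Θ) := by
    have hG := coeffD_inverse D hP
    have hPG := Ring.mul_inverse_cancel P hP
    rw [hs, hΘ, hg]
    simp only [thirdOrder, defect, wron, map_add, map_sub, coeffD_X_pow_mul,
      pow_two (Ring.inverse P), coeffD_mul D (Ring.inverse P), hG]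
    linear_combination 2 * coeffD D a * Ring.inverse P ^ 2 * hPG
  rw [e]
  have hΘ' := X_pow_dvd_coeffD D hu
  have hle : (X : A⟦X⟧) ^ (s - p) ∣ X ^ s := pow_dvd_pow _ (by omega)
  refine dvd_add ?_ (dvd_add ((hle.trans hΘ').mul_left _) ((hle.trans hu).mul_left _))
  rw [PowerSeries.X_pow_dvd_iff]
  intro k hk
  have hself := thirdOrder_self D N u hP
  have hdvd : X ^ s ∣ thirdOrder D N u P := by
    rw [hself]
    exact dvd_add (hΘ'.mul_right _) ((hu.mul_left _).mul_right _)
  have hz := PowerSeries.X_pow_dvd_iff.1 hdvd (k + p) (by omega)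
  -- The left side is O(X^s), so the contributions of the first p terms of P and of the rest are
  -- opposite in degrees below s. Dividing by X^p costs p orders.
  have hsplit : thirdOrder D N u P = thirdOrder D N u (lowS p P) + X ^ p * thirdOrder D N u a := by
    rw [← thirdOrder_X_pow_mul, ← thirdOrder_add, ha, lowS_add_X_pow_mul_shiftS]
  rw [hsplit, map_add, PowerSeries.coeff_X_pow_mul] at hz
  rw [map_sub, hv]
  linear_combination -hz

end Reflect

/-! ### The local elimination -/

section LocalElimination

variable {A : Type u} [CommRing A] [Algebra ℚ A]

/-- The polynomial form of the elimination equations of the local hierarchy. -/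
noncomputable def localEq (D : Derivation ℚ A A) (N : ℕ) (u F : A⟦X⟧) : A⟦X⟧ :=
  X ^ N * (coeffD D F ^ 2 - 2 * F * coeffD D (coeffD D F)) - 1 - u * F ^ 2

lemma localEq_eq (D : Derivation ℚ A A) (N : ℕ) (u : A⟦X⟧) {F : A⟦X⟧} (hF : IsUnit F) :
    localEq D N u F = -(F ^ 2 * defect D N u F) := by
  have h := sq_mul_schw D hF
  have hFG := Ring.mul_inverse_cancel F hF
  rw [localEq, defect, ← h]
  linear_combination (F * Ring.inverse F + 1) * hFG

lemma X_pow_dvd_localEq_iff (D : Derivation ℚ A A) (N : ℕ) (u : A⟦X⟧) {F : A⟦X⟧} (hF : IsUnit F)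
    {K : ℕ} : X ^ K ∣ localEq D N u F ↔ X ^ K ∣ defect D N u F := by
  rw [localEq_eq D N u hF, dvd_neg]
  refine ⟨fun h => ?_, fun h => h.mul_left _⟩
  have h' := h.mul_left (Ring.inverse F ^ 2)
  have e : Ring.inverse F ^ 2 * (F ^ 2 * defect D N u F) = defect D N u F := by
    rw [← mul_assoc, ← mul_pow, Ring.inverse_mul_cancel F hF, one_pow, one_mul]
  rwa [e] at h'

/-- The `k`-th condition on the sequence `q_n, q_{n-1}, …` in the local elimination. -/
def LocalAt (D : Derivation ℚ A A) (W : Set A) (N : ℕ) (u : A⟦X⟧) (k : ℕ) (F : ℕ → A) : Prop :=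
  if k = 0 then F 0 ∈ W ∧ 1 + coeff 0 u * F 0 ^ 2 = 0 else coeff k (localEq D N u (mk F)) = 0

lemma X_pow_dvd_localEq_sub (D : Derivation ℚ A A) (N : ℕ) (u : A⟦X⟧) {f g : A⟦X⟧} {K : ℕ}
    (h : X ^ K ∣ f - g) : X ^ K ∣ localEq D N u f - localEq D N u g := by
  have h1 := X_pow_dvd_coeffD D h
  have h2 := X_pow_dvd_coeffD D h1
  have e : localEq D N u f - localEq D N u g
      = (f - g) * (-u * (f + g) - 2 * X ^ N * coeffD D (coeffD D f))
        + coeffD D (f - g) * (X ^ N * (coeffD D f + coeffD D g))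
        + coeffD D (coeffD D (f - g)) * (-2 * X ^ N * g) := by
    simp only [localEq, map_sub]
    ring
  rw [e]
  exact dvd_add (dvd_add (h.mul_right _) (h1.mul_right _)) (h2.mul_right _)

lemma LocalAt.congr {D : Derivation ℚ A A} {W : Set A} {N : ℕ} {u : A⟦X⟧} (k : ℕ) (f g : ℕ → A)
    (h : ∀ i ≤ k, f i = g i) (hf : LocalAt D W N u k f) : LocalAt D W N u k g := by
  unfold LocalAt at hf ⊢
  split_ifs at hf ⊢ with hk
  · rwa [← h 0 (Nat.zero_le k)]
  · have h' := X_pow_dvd_localEq_sub D N u (X_pow_dvd_mk_sub_mk.2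
      fun i (hi : i < k + 1) => h i (by omega))
    have := PowerSeries.X_pow_dvd_iff.1 h' k (by omega)
    rwa [map_sub, hf, zero_sub, neg_eq_zero] at this

lemma coeff_zero_localEq (D : Derivation ℚ A A) {N : ℕ} (hN : 1 ≤ N) (u F : A⟦X⟧) :
    coeff 0 (localEq D N u F) = -(1 + coeff 0 u * coeff 0 F ^ 2) := by
  rw [localEq, map_sub, map_sub, coeff_zero_mul, coeff_zero_mul, pow_two F, coeff_zero_mul,
    PowerSeries.coeff_X_pow, if_neg (by omega), PowerSeries.coeff_zero_one]
  ring

lemma forall_localAt_iff (D : Derivation ℚ A A) {W : Set A} {N : ℕ} (hN : 1 ≤ N) (u : A⟦X⟧)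
    {F : ℕ → A} (hF : IsUnit (F 0)) (hW : F 0 ∈ W) {K : ℕ} :
    (∀ k < K, LocalAt D W N u k F) ↔ X ^ K ∣ defect D N u (mk F) := by
  rw [← X_pow_dvd_localEq_iff D N u (isUnit_mk hF), PowerSeries.X_pow_dvd_iff]
  refine forall₂_congr fun k _ => ?_
  rw [LocalAt]
  split_ifs with h
  · rw [h, coeff_zero_localEq D hN, PowerSeries.coeff_mk, neg_eq_zero]
    exact and_iff_right hW
  · rfl

/-- All derivatives of c carry the factor X^(k+N) with N ≥ 1 and so miss degree k. The equation for
c is algebraic and linear, which is why this hierarchy is local. -/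
lemma coeff_localEq_update (D : Derivation ℚ A A) {N : ℕ} (hN : 1 ≤ N) (u : A⟦X⟧) (F : ℕ → A)
    {k : ℕ} (hk : 1 ≤ k) (c : A) :
    coeff k (localEq D N u (mk (Function.update F k c)))
      = coeff k (localEq D N u (mk (Function.update F k 0))) - 2 * (coeff 0 u * F 0 * c) := by
  rw [mk_update]
  have h0 : coeff 0 (mk (Function.update F k 0)) = F 0 := by
    rw [PowerSeries.coeff_mk, Function.update_of_ne (by omega)]
  generalize mk (Function.update F k 0) = f at h0 ⊢
  have hc : coeffD D (f + C c * X ^ k) = coeffD D f + X ^ k * coeffD D (C c) := by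
    rw [map_add, mul_comm, coeffD_X_pow_mul]
  have hcc : coeffD D (coeffD D (f + C c * X ^ k))
      = coeffD D (coeffD D f) + X ^ k * coeffD D (coeffD D (C c)) := by
    rw [hc, map_add, coeffD_X_pow_mul]
  have e : localEq D N u (f + C c * X ^ k) = localEq D N u f + X ^ k *
      (X ^ N * (coeffD D (C c) * (2 * coeffD D f + X ^ k * coeffD D (C c))
        - 2 * f * coeffD D (coeffD D (C c)) - 2 * C c * coeffD D (coeffD D (f + C c * X ^ k)))
        - u * (C c * (f + f + C c * X ^ k))) := by
    rw [localEq, localEq, hcc, hc]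
    ring
  rw [e, map_add, PowerSeries.coeff_X_pow_mul', if_pos le_rfl, Nat.sub_self, map_sub,
    coeff_zero_mul, coeff_zero_mul, PowerSeries.coeff_X_pow, if_neg (by omega), zero_mul,
    coeff_zero_mul, map_add, map_add, coeff_zero_mul, PowerSeries.coeff_X_pow, if_neg (by omega), h0,
    PowerSeries.coeff_zero_C]
  ring

lemma exists_local_seq {D : Derivation ℚ A A} {W : Set A} {N : ℕ} (hN : 1 ≤ N) {u : A⟦X⟧} {b : A}
    (hb : b ∈ W) (hu : 1 + coeff 0 u * b ^ 2 = 0) : ∃ F, ∀ k, LocalAt D W N u k F := by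
  have : Inhabited A := ⟨0⟩
  refine exists_seq_of_triangular _ LocalAt.congr fun k F hF => ?_
  rcases Nat.eq_zero_or_pos k with rfl | hk
  · refine ⟨b, ?_⟩
    rw [LocalAt, if_pos rfl, Function.update_self]
    exact ⟨hb, hu⟩
  · have h0 := hF 0 hk
    rw [LocalAt, if_pos rfl] at h0
    obtain ⟨r, hr⟩ : ∃ r, coeff k (localEq D N u (mk (Function.update F k 0))) = r := ⟨_, rfl⟩
    -- The solution is r / (2 u_0 F_0), and u_0 F_0² = -1 turns 1 / (u_0 F_0) into -F_0.
    refine ⟨-(F 0 * ((1 / 2 : ℚ) • r)), ?_⟩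
    rw [LocalAt, if_neg (by omega), coeff_localEq_update D hN u F hk, hr]
    linear_combination 2 * ((1 / 2 : ℚ) • r) * h0.2 - two_mul_half_smul r

lemma local_seq_unique {D : Derivation ℚ A A} {W : Set A} (hW : IsBranch W) {N : ℕ} (hN : 1 ≤ N)
    {u : A⟦X⟧} {K : ℕ} {F G : ℕ → A} (hF : ∀ k < K, LocalAt D W N u k F)
    (hG : ∀ k < K, LocalAt D W N u k G) : ∀ k < K, F k = G k := by
  refine seq_unique_of_triangular _ LocalAt.congr (fun k f hf c c' hc hc' => ?_) hF hG
  rcases Nat.eq_zero_or_pos k with rfl | hk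
  · rw [LocalAt, if_pos rfl, Function.update_self] at hc hc'
    refine hW.2 hc.1 hc'.1 ?_
    simp only
    linear_combination c ^ 2 * hc'.2 - c' ^ 2 * hc.2
  · have h0 := hf 0 hk
    rw [LocalAt, if_pos rfl] at h0
    rw [LocalAt, if_neg (by omega), coeff_localEq_update D hN u f hk] at hc hc'
    rw [← sub_eq_zero]
    apply eq_zero_of_two_mul_eq_zero
    linear_combination 2 * (c - c') * h0.2 + f 0 * (hc - hc')

lemma polyPart_congr (D : Derivation ℚ A A) {N : ℕ} {f g : ℕ → A} (h : ∀ k ≤ N, f k = g k) :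
    polyPart D N (mk f) = polyPart D N (mk g) := by
  ext k
  rw [polyPart, polyPart, PowerSeries.coeff_mk, PowerSeries.coeff_mk]
  split_ifs with hk
  · exact coeff_schw_congr D fun i hi => h i (by omega)
  · rfl

lemma coord_eq_of_forall {N n : ℕ} {q : Fin N → A} {Q : Fin n → A}
    (h : ∀ j : Fin N, coord Q (j + 1) = q j) {k : ℕ} (hk : k ≤ N) : coord Q k = coord q k := by
  rcases Nat.eq_zero_or_pos k with rfl | h'
  · rfl
  · have := h ⟨k - 1, by omega⟩
    rwa [← coord_of_pos q h' hk, Nat.sub_add_cancel h'] at this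

/-- As `polyPart` involves only the first N entries, it is fixed data here. The conditions on q_n,
q_{n-1}, … then depend on n only through their number. -/
lemma isLocalElim_iff (D : Derivation ℚ A A) {W : Set A} (hW : IsBranch W) {N n : ℕ} (hN : 1 ≤ N)
    (hn : N < n) (q : Fin N → A) (Q : Fin n → A) :
    IsLocalElim D W q Q ↔ (∀ j : Fin N, coord Q (j + 1) = q j) ∧
      ∀ k < n - N, LocalAt D W N (polyPart D N (mk (coord q))) k (rev Q) := by
  refine and_congr_right fun h1 => ?_
  have hu : polyPart D N (mk (coord q)) = polyPart D N (mk (coord Q)) :=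
    polyPart_congr D fun k hk => (coord_eq_of_forall h1 hk).symm
  have key : ∀ hw : coord Q n ∈ W, (∀ i : Fin n, (i : ℕ) + N < n →
      eulerLagrange D ((n : ℤ) - N) (-(n : ℤ)) (-1) Q i = 0) ↔
      ∀ k < n - N, LocalAt D W N (polyPart D N (mk (coord q))) k (rev Q) := fun hw => by
    have hq := hW.1 _ hw
    rw [forall_localAt_iff D hN _ (by rwa [rev_zero]) (by rwa [rev_zero]),
      PowerSeries.X_pow_dvd_iff, hu, defect]
    constructor
    · intro h k hk
      have := h ⟨k, by omega⟩ (by simp only; omega)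
      rwa [eulerLagrange_local D Q hq _ (by simp only; omega), quarter_smul_eq_zero] at this
    · intro h i hi
      rw [eulerLagrange_local D Q hq i hi, quarter_smul_eq_zero]
      exact h i (by omega)
  constructor
  · rintro ⟨hw, h⟩
    exact (key hw).1 h
  · intro h
    have h0 := h 0 (by omega)
    rw [LocalAt, if_pos rfl, rev_zero] at h0
    exact ⟨h0.1, (key h0.1).2 h⟩

/-- The point with the first entries `q` and the last entries `…, F 1, F 0`. -/
def localVec {N : ℕ} (q : Fin N → A) (F : ℕ → A) (n : ℕ) : Fin n → A :=
  fun i => if h : (i : ℕ) < N then q ⟨i, h⟩ else F (n - 1 - i)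

lemma coord_localVec_of_le {N n : ℕ} (hn : N ≤ n) (q : Fin N → A) (F : ℕ → A) {k : ℕ}
    (hk : k ≤ N) : coord (localVec q F n) k = coord q k := by
  rcases Nat.eq_zero_or_pos k with rfl | h'
  · rfl
  · rw [coord_of_pos q h' hk, coord_of_pos _ h' (by omega), localVec, dif_pos (by simp only; omega)]

lemma coord_localVec_of_lt {N n : ℕ} (q : Fin N → A) (F : ℕ → A) {k : ℕ} (hk : N < k)
    (hkn : k ≤ n) : coord (localVec q F n) k = F (n - k) := by
  rw [coord_of_pos _ (by omega) hkn, localVec, dif_neg (by simp only; omega)]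
  congr 1
  simp only
  omega

lemma rev_localVec {N n : ℕ} (q : Fin N → A) (F : ℕ → A) {k : ℕ} (hk : k < n - N) :
    rev (localVec q F n) k = F k := by
  rw [rev, if_pos (by omega), coord_localVec_of_lt q F (by omega) (by omega),
    Nat.sub_sub_self (by omega)]

lemma isLocalElim_localVec {D : Derivation ℚ A A} {W : Set A} (hW : IsBranch W) {N n : ℕ}
    (hN : 1 ≤ N) (hn : N < n) {q : Fin N → A} {F : ℕ → A}
    (hF : ∀ k < n - N, LocalAt D W N (polyPart D N (mk (coord q))) k F) :
    IsLocalElim D W q (localVec q F n) := by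
  rw [isLocalElim_iff D hW hN hn]
  refine ⟨fun j => ?_, fun k hk => ?_⟩
  · rw [coord_localVec_of_le hn.le q F (by omega), coord_succ]
  · exact (hF k hk).congr k _ _ fun i hi => (rev_localVec q F (by omega)).symm

lemma isLocalElim_unique {D : Derivation ℚ A A} {W : Set A} (hW : IsBranch W) {N n : ℕ}
    (hN : 1 ≤ N) (hn : N < n) {q : Fin N → A} {Q Q' : Fin n → A} (h : IsLocalElim D W q Q)
    (h' : IsLocalElim D W q Q') : Q = Q' := by
  rw [isLocalElim_iff D hW hN hn] at h h'
  ext i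
  rw [← coord_succ Q, ← coord_succ Q']
  rcases Nat.lt_or_ge i N with hi | hi
  · rw [coord_eq_of_forall h.1 (by omega), coord_eq_of_forall h'.1 (by omega)]
  · have := local_seq_unique hW hN h.2 h'.2 (n - (i + 1)) (by omega)
    rwa [rev, rev, if_pos (by omega), if_pos (by omega), Nat.sub_sub_self (by omega)] at this

lemma localElim_eq {D : Derivation ℚ A A} {W : Set A} (hW : IsBranch W) {N n : ℕ}
    (hN : 1 ≤ N) (hn : N < n) {q : Fin N → A} {F : ℕ → A}
    (hF : ∀ k, LocalAt D W N (polyPart D N (mk (coord q))) k F) :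
    localElim D W n q = localVec q F n := by
  have h' := isLocalElim_localVec hW hN hn fun k _ => hF k
  have h : ∃ Q : Fin n → A, IsLocalElim D W q Q := ⟨_, h'⟩
  rw [localElim, dif_pos h]
  exact isLocalElim_unique hW hN hn h.choose_spec h'

lemma localDomain_iff (D : Derivation ℚ A A) {W : Set A} (hW : IsBranch W) {N : ℕ} (hN : 1 ≤ N)
    (q : Fin N → A) :
    LocalDomain D W q ↔ ∃ b ∈ W, 1 + coeff N (schw D (mk (coord q))) * b ^ 2 = 0 := by
  have hu : coeff 0 (polyPart D N (mk (coord q))) = coeff N (schw D (mk (coord q))) := by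
    rw [polyPart, PowerSeries.coeff_mk, if_pos (Nat.zero_le N), Nat.sub_zero]
  constructor
  · rintro ⟨Q, hQ⟩
    have := ((isLocalElim_iff D hW hN (by omega) q Q).1 hQ).2 0 (by omega)
    rw [LocalAt, if_pos rfl, hu] at this
    exact ⟨_, this⟩
  · rintro ⟨b, hb, h⟩
    obtain ⟨F, hF⟩ := exists_local_seq (D := D) hN hb (u := polyPart D N (mk (coord q)))
      (by rwa [hu])
    exact ⟨_, isLocalElim_localVec hW hN (by omega) fun k _ => hF k⟩

lemma LocalDomain.exists_seq {D : Derivation ℚ A A} {W : Set A} (hW : IsBranch W) {N : ℕ}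
    (hN : 1 ≤ N) {q : Fin N → A} (h : LocalDomain D W q) :
    ∃ F, ∀ k, LocalAt D W N (polyPart D N (mk (coord q))) k F := by
  obtain ⟨b, hb, h⟩ := (localDomain_iff D hW hN q).1 h
  refine exists_local_seq hN hb ?_
  rwa [polyPart, PowerSeries.coeff_mk, if_pos (Nat.zero_le N), Nat.sub_zero]

lemma isBranch_localLift {W : Set A} (hW : IsBranch W) : IsBranch (localLift A W) := by
  refine ⟨fun b hb => isUnit_iff_isUnit_fst.2 (hW.1 _ hb), fun b hb c hc h => ?_⟩
  simp only [pow_two] at h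
  have h1 : b.fst = c.fst := hW.2 hb hc (by simpa [pow_two] using congrArg fst h)
  have h2 := congrArg snd h
  simp only [snd_mul, smul_eq_mul, MulOpposite.smul_eq_mul_unop, MulOpposite.unop_op, h1] at h2
  ext
  · exact h1
  · rw [← sub_eq_zero]
    apply eq_zero_of_two_mul_eq_zero
    apply (hW.1 _ hc).mul_left_cancel
    linear_combination h2

lemma localDomain_dual {D : Derivation ℚ A A} {W : Set A} (hW : IsBranch W) {N : ℕ} (hN : 1 ≤ N)
    {q : Fin N → A} (h : LocalDomain D W q) (v : Fin N → A) :
    LocalDomain (dualD D) (localLift A W) fun j => pt (q j) (v j) := by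
  obtain ⟨b, hb, h⟩ := (localDomain_iff D hW hN q).1 h
  obtain ⟨d, hd⟩ : ∃ d, coeff N (schw (dualD D) (mk (coord fun j => pt (q j) (v j))))
      = pt (coeff N (schw D (mk (coord q)))) d :=
    ⟨_, by rw [mk_coord_pt, schw_ptS D (isUnit_mk_coord q), coeff_ptS]⟩
  rw [localDomain_iff _ (isBranch_localLift hW) hN, hd]
  generalize coeff N (schw D (mk (coord q))) = a at h
  -- The ε-part solves the linearised equation d b² + 2 a b b' = 0, where a b² = -1.
  refine ⟨pt b (b ^ 3 * ((1 / 2 : ℚ) • d)), by simpa [localLift] using hb, ?_⟩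
  have hd := two_mul_half_smul d
  generalize (1 / 2 : ℚ) • d = d' at hd ⊢
  ext
  · simpa [pow_two] using h
  · simp only [pow_two (pt _ _), snd_add, snd_mul, fst_mul, snd_one, fst_pt, snd_pt, smul_eq_mul,
      MulOpposite.smul_eq_mul_unop, MulOpposite.unop_op, snd_zero]
    linear_combination 2 * b ^ 2 * d' * h - b ^ 2 * hd

/-- Allows points with different n to be compared by counting the high entries from the end; this
gives independence of s. -/
lemma killing_reindex (D : Derivation ℚ A A) {r r' : ℕ} {Q Q' : ℕ → A} {l : ℕ}
    (hl : 1 ≤ l) (hr : 1 ≤ r) (hr' : 1 ≤ r') (h : ∀ k, 1 ≤ k → k < l → Q k = Q' k)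
    (h' : ∀ k < l, Q (r + k) = Q' (r' + k)) : killing D r Q l = killing D r' Q' l := by
  have e : ∀ (r : ℕ) (Q : ℕ → A), 1 ≤ r → killing D r Q l = D (Q (r + (l - 1)))
      + ∑ k ∈ Finset.Icc 1 (l - 1), (Q k * D (Q (r + (l - 1 - k)))
        - Q (r + (l - 1 - k)) * D (Q k)) := fun r Q hr => by
    rw [killing, show l + r - 1 = r + (l - 1) by omega]
    congr 1
    refine Finset.sum_congr rfl fun k hk => ?_
    rw [Finset.mem_Icc] at hk
    rw [show l + r - k - 1 = r + (l - 1 - k) by omega]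
  rw [e r Q hr, e r' Q' hr', h' _ (by omega)]
  congr 1
  refine Finset.sum_congr rfl fun k hk => ?_
  rw [Finset.mem_Icc] at hk
  rw [h k (by omega) (by omega), h' _ (by omega)]

lemma localField_apply {D : Derivation ℚ A A} {W : Set A} (hW : IsBranch W) {N : ℕ}
    (hN : 1 ≤ N) {q : Fin N → A} {F : ℕ → A}
    (hF : ∀ k, LocalAt D W N (polyPart D N (mk (coord q))) k F) {s p : ℕ} (hs : 1 ≤ s)
    (j : Fin N) : localField N s p A D W q j
      = killing D (s + N - p + 1) (coord (localVec q F (s + N))) (j + 1) := by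
  rw [localField, localElim_eq hW hN (by omega) hF]

lemma localField_eq {D : Derivation ℚ A A} {W : Set A} (hW : IsBranch W) {N : ℕ}
    (hN : 1 ≤ N) {q : Fin N → A} {F : ℕ → A}
    (hF : ∀ k, LocalAt D W N (polyPart D N (mk (coord q))) k F) {s p : ℕ} (hp : 1 ≤ p)
    (hs : p ≤ s) : localField N s p A D W q = Xbar N p A D W q := by
  ext j
  rw [Xbar, localField_apply hW hN hF (by omega), localField_apply hW hN hF hp]
  refine killing_reindex D (by omega) (by omega) (by omega) (fun k _ hk => ?_) fun k hk => ?_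
  · rw [coord_localVec_of_le (by omega) q F (by omega),
      coord_localVec_of_le (by omega) q F (by omega)]
  · rcases Nat.lt_or_ge k p with h | h
    · rw [coord_localVec_of_lt q F (by omega) (by omega),
        coord_localVec_of_lt q F (by omega) (by omega)]
      congr 1
      omega
    · rw [coord_of_lt _ (by omega), coord_of_lt _ (by omega)]

end LocalElimination

/-! ### The local hierarchy -/

section Local

variable {A : Type u} [CommRing A] [Algebra ℚ A]

lemma mk_rev_eq_reflS {n : ℕ} (Q : Fin n → A) : mk (rev Q) = reflS n (mk (coord Q)) := by
  ext k
  rw [coeff_reflS, PowerSeries.coeff_mk, PowerSeries.coeff_mk, rev]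

lemma polyPart_eq_reflS (D : Derivation ℚ A A) (N : ℕ) (f : A⟦X⟧) :
    polyPart D N f = reflS N (schw D f) := rfl

lemma reflS_ptS (d : ℕ) (f g : A⟦X⟧) : reflS d (ptS f g) = ptS (reflS d f) (reflS d g) := by
  ext k
  all_goals
    simp only [coeff_reflS, coeff_ptS]
    split_ifs <;> simp

lemma degLE_mk_coord {n : ℕ} (Q : Fin n → A) : DegLE (mk (coord Q)) n := fun k hk => by
  rw [PowerSeries.coeff_mk, coord_of_lt Q hk]

lemma flow_of_lt (D : Derivation ℚ A A) {n r : ℕ} (hr : 1 ≤ r) (Q : Fin n → A) {k : ℕ}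
    (hk : n < k) : flow D r (coord Q) k = 0 := by
  rw [flow, if_neg (by omega), coord_of_lt Q hk, killing_eq_coeff D r (coord_zero Q) (by omega),
    degLE_killS D hr (degLE_mk_coord Q) k hk, pt_zero_zero]

/-- The sequence of the last entries of the flow. -/
noncomputable def revFlow (D : Derivation ℚ A A) (r : ℕ) {n : ℕ} (Q : Fin n → A) (k : ℕ) :
    DualNumber A :=
  if k ≤ n then flow D r (coord Q) (n - k) else 0

lemma mk_revFlow (D : Derivation ℚ A A) (r : ℕ) {n : ℕ} (Q : Fin n → A) :
    mk (revFlow D r Q) = ptS (mk (rev Q)) (reflS n (killS D r (mk (coord Q)))) := by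
  rw [mk_rev_eq_reflS, ← reflS_ptS, ← mk_flow D r (coord_zero Q)]
  ext k
  · rw [coeff_reflS, PowerSeries.coeff_mk, PowerSeries.coeff_mk, revFlow]
  · rw [coeff_reflS, PowerSeries.coeff_mk, PowerSeries.coeff_mk, revFlow]

/-- The elimination equations of the local hierarchy are preserved by the flow of `Z_{n-p+1}` up to
a shift of the order by `p`. -/
lemma localAt_revFlow {D : Derivation ℚ A A} {W : Set A} (hW : IsBranch W) {N n p : ℕ}
    (hN : 1 ≤ N) (hn : N < n) (hp : 1 ≤ p) (hpn : p ≤ n) {q : Fin N → A} {Q : Fin n → A}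
    (hQ : IsLocalElim D W q Q) {k : ℕ} (hk : k < n - N - p) :
    LocalAt (dualD D) (localLift A W) N
      (polyPart (dualD D) N (mk (coord fun j => pt (q j) (killing D (n - p + 1) (coord Q) (j + 1)))))
      k (revFlow D (n - p + 1) Q) := by
  obtain ⟨h1, h2⟩ := (isLocalElim_iff D hW hN hn q Q).1 hQ
  have hw : rev Q 0 ∈ W := by
    rw [rev_zero]
    exact hQ.2.1
  have hu0 : IsUnit (rev Q 0) := hW.1 _ hw
  have hP := isUnit_mk hu0
  have hQu := isUnit_mk_coord Q
  have hr0 : (revFlow D (n - p + 1) Q 0).fst = rev Q 0 := by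
    rw [revFlow, if_pos (Nat.zero_le n), flow, fst_pt, Nat.sub_zero, rev_zero]
  have hu : polyPart D N (mk (coord q)) = polyPart D N (mk (coord Q)) :=
    polyPart_congr D fun k hk => (coord_eq_of_forall h1 hk).symm
  have hu' : polyPart (dualD D) N
      (mk (coord fun j => pt (q j) (killing D (n - p + 1) (coord Q) (j + 1))))
      = polyPart (dualD D) N (mk (flow D (n - p + 1) (coord Q))) := by
    refine polyPart_congr _ fun k hk => ?_
    rcases Nat.eq_zero_or_pos k with rfl | hk'
    · rw [coord_zero, flow_zero _ _ (coord_zero Q)]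
    · rw [coord_of_pos _ hk' hk, flow, if_neg (by omega), coord_eq_of_forall h1 hk,
        coord_of_pos q hk' hk]
      simp only
      rw [Nat.sub_add_cancel hk']
  refine (forall_localAt_iff (dualD D) hN _ (K := n - N - p) (isUnit_iff_isUnit_fst.2 ?_) ?_).2 ?_
    k hk
  · rwa [hr0]
  · rw [← hr0] at hw
    exact hw
  rw [forall_localAt_iff D hN _ hu0 hw, hu] at h2
  have hkill : X ^ 0 * killS D (n - p + 1) (mk (coord Q))
      = wron D (-(X * shiftS (n - p + 1) (mk (coord Q)))) (mk (coord Q)) := by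
    rw [pow_zero, one_mul, killS, wron, wron, map_neg, coeffD_mul, coeffD_X]
    ring
  have hflow := schw_flow D hQu hkill
  rw [pow_zero, one_mul] at hflow
  rw [hu', polyPart_eq_reflS, mk_flow D _ (coord_zero Q), schw_ptS D hQu, hflow, reflS_ptS,
    ← polyPart_eq_reflS, mk_revFlow, defect_ptS D N _ _ hP]
  have hvar := X_pow_dvd_defect_variation D N hP (p := p)
    (g := reflS n (killS D (n - p + 1) (mk (coord Q)))) h2 (by
    rw [mk_rev_eq_reflS]
    exact reflS_killS D hpn (degLE_mk_coord Q)) (fun k => by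
    rw [mk_rev_eq_reflS, polyPart_eq_reflS]
    exact coeff_variation_polyPart D (N := N) hp hpn (S := schw D (mk (coord Q)))
      (degLE_mk_coord Q) k)
  rw [PowerSeries.X_pow_dvd_iff] at h2 hvar ⊢
  intro m hm
  rw [coeff_ptS, h2 m (by omega), hvar m hm, pt_zero_zero]

/-- The equations do not contain x explicitly, so along q_x the defect varies by its own
x-derivative. No order is lost. -/
lemma localAt_translation {D : Derivation ℚ A A} {W : Set A} (hW : IsBranch W) {N : ℕ}
    (hN : 1 ≤ N) {q : Fin N → A} {F : ℕ → A}
    (hF : ∀ k, LocalAt D W N (polyPart D N (mk (coord q))) k F) (k : ℕ) :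
    LocalAt (dualD D) (localLift A W) N (polyPart (dualD D) N (mk (coord fun j => pt (q j) (D (q j)))))
      k (fun k => pt (F k) (D (F k))) := by
  have hw : F 0 ∈ W := by
    have := hF 0
    rw [LocalAt, if_pos rfl] at this
    exact this.1
  have hu0 := hW.1 _ hw
  refine (forall_localAt_iff (dualD D) hN _ (K := k + 1) (isUnit_iff_isUnit_fst.2 ?_) ?_).2 ?_
    k (by omega)
  · rwa [fst_pt]
  · change (pt (F 0) (D (F 0))).fst ∈ W
    rwa [fst_pt]
  have h := (forall_localAt_iff D hN _ hu0 hw (K := k + 1)).1 fun k _ => hF k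
  have hm : mk (fun k => pt (F k) (D (F k))) = ptS (mk F) (coeffD D (mk F)) := by
    ext k <;> simp
  have hP := isUnit_mk hu0
  rw [mk_coord_pt, ← coeffD_mk_coord, polyPart_eq_reflS, schw_ptS_coeffD D (isUnit_mk_coord q),
    reflS_ptS, reflS_coeffD, ← polyPart_eq_reflS, hm]
  generalize polyPart D N (mk (coord q)) = u at h ⊢
  have e : defect (dualD D) N (ptS u (coeffD D u)) (ptS (mk F) (coeffD D (mk F)))
      = ptS (defect D N u (mk F)) (coeffD D (defect D N u (mk F))) := by
    rw [defect, schw_ptS_coeffD D hP, inverse_ptS hP, ← ptS_X_pow, pow_two, ptS_mul, ptS_mul,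
      ptS_sub, ptS_add, defect]
    simp only [map_add, map_sub, coeffD_X_pow_mul, pow_two (Ring.inverse (mk F)), coeffD_mul D
      (Ring.inverse (mk F)), coeffD_inverse D hP]
    congr 1
    ring
  have h' := X_pow_dvd_coeffD D h
  rw [e]
  rw [PowerSeries.X_pow_dvd_iff] at h h' ⊢
  intro m hm
  rw [coeff_ptS, h m hm, h' m hm, pt_zero_zero]

/-- The p-th field sees only the first N and the last p entries, so the elimination over A[ε] need
agree with the flow in its first p terms only. -/
lemma localField_dual {D : Derivation ℚ A A} {W : Set A} (hW : IsBranch W) {N : ℕ} (hN : 1 ≤ N)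
    {q : Fin N → A} {s p r : ℕ} (hp : 1 ≤ p) (hs : p ≤ s) (hr : 1 ≤ r)
    {P : Fin (s + N) → A} (hP : ∀ j : Fin N, coord P (j + 1) = q j)
    {F : ℕ → DualNumber A}
    (hF : ∀ k, LocalAt (dualD D) (localLift A W) N
      (polyPart (dualD D) N (mk (coord fun j => pt (q j) (killing D r (coord P) (j + 1))))) k F)
    (hFP : ∀ k < p, F k = flow D r (coord P) (s + N - k)) (l : Fin N) :
    Xbar N p (DualNumber A) (dualD D) (localLift A W)
        (fun m => pt (q m) (killing D r (coord P) (m + 1))) l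
      = killing (dualD D) (s + N - p + 1) (flow D r (coord P)) (l + 1) := by
  rw [← localField_eq (isBranch_localLift hW) hN hF hp hs,
    localField_apply (isBranch_localLift hW) hN hF (by omega)]
  refine killing_congr (dualD D) _ (by omega) (by omega) fun k hk _ hk' => ?_
  rcases Nat.lt_or_ge N k with h | h
  · rcases Nat.lt_or_ge (s + N) k with hn | hn
    · rw [coord_of_lt _ hn, flow_of_lt D hr P hn]
    · rw [coord_localVec_of_lt _ F h hn, hFP _ (by omega), Nat.sub_sub_self hn]
  · rw [coord_localVec_of_le (by omega) _ F h, coord_of_pos _ hk h, flow, if_neg (by omega),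
      coord_eq_of_forall hP h, coord_of_pos q hk h]
    simp only
    rw [Nat.sub_add_cancel hk]

theorem local_hierarchy {N : ℕ} (hN : 1 ≤ N) (D : Derivation ℚ A A) (W : Set A) (hW : IsBranch W)
    (q : Fin N → A) (hq : LocalDomain D W q) :
    (∀ v : Fin N → A, LocalDomain (dualD D) (localLift A W) (fun j => pt (q j) (v j))) ∧
    (∀ s : ℕ, 1 ≤ s →
      (∃! Q : Fin (s + N) → A, IsLocalElim D W q Q) ∧
      ∀ p : ℕ, 1 ≤ p → p ≤ s → localField N s p A D W q = Xbar N p A D W q) ∧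
    (∀ i j : ℕ, 1 ≤ i → 1 ≤ j →
      bracket localLift (Xbar.{u} N i) (Xbar.{u} N j) A D W q = 0) ∧
    (∀ i : ℕ, 1 ≤ i →
      bracket localLift (Xbar.{u} N i) (translation.{u} N) A D W q = 0) := by
  obtain ⟨F, hF⟩ := hq.exists_seq hW hN
  have hW' := isBranch_localLift hW
  have hX : ∀ s p, 1 ≤ p → p ≤ s → Xbar N p A D W q = fun l : Fin N =>
      killing D (s + N - p + 1) (coord (localVec q F (s + N))) (l + 1) := fun s p hp hs => by
    rw [← localField_eq hW hN hF hp hs]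
    exact funext fun l => localField_apply hW hN hF (by omega) l
  have helim : ∀ s, 1 ≤ s → IsLocalElim D W q (localVec q F (s + N)) := fun s hs =>
    isLocalElim_localVec hW hN (by omega) fun k _ => hF k
  refine ⟨localDomain_dual hW hN hq, fun s hs => ⟨⟨_, helim s hs, fun Q hQ =>
    isLocalElim_unique hW hN (by omega) hQ (helim s hs)⟩, fun p hp hps =>
    localField_eq hW hN hF hp hps⟩, fun i j hi hj => ?_, fun i hi => ?_⟩
  -- With n = i + j + N there are i + j elimination equations. The i-th flow preserves the first j
  -- of them, exactly those that fix the entries seen by the j-th field.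
  · have key : ∀ i j, 1 ≤ i → 1 ≤ j → ∀ l : Fin N,
        Xbar N j (DualNumber A) (dualD D) (localLift A W)
          (fun m => pt (q m) (Xbar N i A D W q m)) l
        = killing (dualD D) (i + j + N - j + 1)
          (flow D (i + j + N - i + 1) (coord (localVec q F (i + j + N)))) (l + 1) := by
      intro i j hi hj l
      rw [hX (i + j) i hi (by omega)]
      obtain ⟨G, hG⟩ := (localDomain_dual hW hN hq fun l =>
        killing D (i + j + N - i + 1) (coord (localVec q F (i + j + N))) (l + 1)).exists_seq hW' hN
      have he := helim (i + j) (by omega)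
      refine localField_dual hW hN hj (by omega) (by omega) he.1 hG (fun k hk => ?_) l
      have := local_seq_unique hW' hN (fun k _ => hG k) (fun k hk => localAt_revFlow hW hN
        (by omega) hi (by omega) he (k := k) hk) k (by omega)
      rw [this, revFlow, if_pos (by omega)]
    ext l
    rw [bracket, key i j hi hj, key j i hj hi, add_comm j i,
      killing_flow_comm D (by omega) (by omega) (coord_zero _) (by omega), sub_self, Pi.zero_apply]
  · have he := helim i hi
    have ht : translation N A D W q = fun j : Fin N =>
        killing D 1 (coord (localVec q F (i + N))) (j + 1) := funext fun j => by
      rw [killing_one D _ (by omega), he.1 j, translation]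
    have ht' : (fun j : Fin N => pt (q j) (D (q j))) = fun j : Fin N =>
        pt (q j) (killing D 1 (coord (localVec q F (i + N))) (j + 1)) := funext fun j => by
      rw [killing_one D _ (by omega), he.1 j]
    have hG := localAt_translation hW hN hF
    rw [ht'] at hG
    have hGF : ∀ k < i, pt (F k) (D (F k))
        = flow D 1 (coord (localVec q F (i + N))) (i + N - k) := fun k hk => by
      rw [flow, if_neg (by omega), killing_one D _ (by omega), coord_localVec_of_lt q F (by omega)
        (by omega), Nat.sub_sub_self (by omega)]
    ext l
    rw [bracket, ht, localField_dual hW hN hi le_rfl le_rfl he.1 hG hGF,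
      killing_flow_comm D le_rfl (by omega) (coord_zero _) (by omega),
      killing_one _ _ (by omega), hX i i hi le_rfl, translation, flow, if_neg (by omega), dualD_pt,
      dualD_pt, snd_pt, snd_pt, sub_self, Pi.zero_apply]

end Local

end HarryDym

open HarryDym in
theorem mainTheorem3 (N : ℕ) (hN : 1 ≤ N) :
    -- the nonlocal hierarchy, on function spaces `V` on which `∂` is invertible
    (∀ (A : Type u) [CommRing A] [Algebra ℚ A] (D : Derivation ℚ A A)
        (V : NonUnitalSubalgebra ℚ A), Set.BijOn D (V : Set A) (V : Set A) →
      ∀ q : Fin N → A, (∀ j, q j ∈ V) →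
        (∀ s : ℕ, 2 ≤ s →
          (∃! Q : Fin (s + N - 1) → A, IsNonlocalElim D (V : Set A) q Q) ∧
          ∀ r : ℕ, 2 ≤ r → r ≤ s → nonlocalField N s r A D V q = Zbar N r A D V q) ∧
        (∀ r : ℕ, 2 ≤ r → ∀ j, Zbar N r A D V q j ∈ V) ∧
        (∀ i j : ℕ, 2 ≤ i → 2 ≤ j →
          bracket nonlocalLift (Zbar.{u} N i) (Zbar.{u} N j) A D V q = 0) ∧
        (∀ i : ℕ, 2 ≤ i →
          bracket nonlocalLift (Zbar.{u} N i) (translation.{u} N) A D V q = 0)) ∧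
    -- the nonlocal hierarchy with arbitrary integration parameters
    (∀ (A : Type u) [CommRing A] [Algebra ℚ A] (D : Derivation ℚ A A) (Q : ℕ → A),
      SolvesElim D N Q →
        (∀ r : ℕ, 1 ≤ r → SolvesElim (dualD D) N (fun j => pt (Q j) (killing D r Q j))) ∧
        (∀ i j : ℕ, 1 ≤ i → 1 ≤ j → ∀ l : ℕ, 1 ≤ l →
          (killing (dualD D) j (fun k => pt (Q k) (killing D i Q k)) l).snd
            = (killing (dualD D) i (fun k => pt (Q k) (killing D j Q k)) l).snd)) ∧
    -- the local hierarchy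
    (∀ (A : Type u) [CommRing A] [Algebra ℚ A] (D : Derivation ℚ A A) (W : Set A),
      IsBranch W → ∀ q : Fin N → A, LocalDomain D W q →
        (∀ v : Fin N → A, LocalDomain (dualD D) (localLift A W) (fun j => pt (q j) (v j))) ∧
        (∀ s : ℕ, 1 ≤ s →
          (∃! Q : Fin (s + N) → A, IsLocalElim D W q Q) ∧
          ∀ p : ℕ, 1 ≤ p → p ≤ s → localField N s p A D W q = Xbar N p A D W q) ∧
        (∀ i j : ℕ, 1 ≤ i → 1 ≤ j →
          bracket localLift (Xbar.{u} N i) (Xbar.{u} N j) A D W q = 0) ∧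
        (∀ i : ℕ, 1 ≤ i →
          bracket localLift (Xbar.{u} N i) (translation.{u} N) A D W q = 0)) := by
  refine ⟨fun A _ _ D V hV q hq => nonlocal_hierarchy D V hV q hq, fun A _ _ D Q hQ =>
    ⟨fun r hr => solvesElim_flow D hQ hr, fun i j hi hj l hl => killing_comm D hi hj Q hl⟩,
    fun A _ _ D W hW q hq => local_hierarchy hN D W hW q hq⟩
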